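/- **Privacy of FL-CS-DP.** Let $0<C\le 1$, $S>0$, $\sigma>0$, $m\le n$, let $T_{\mathsf{cl}}\ge 1$ be the number of rounds and $0<\delta<1$. There are $N$ client slots; a federation $D$ assigns to each slot $k$ a local dataset $D_k$ or "absent". Two federations are adjacent if they are equal or one arises from the other by removing one client together with its whole dataset (client-level adjacency). *Protocol FL-CS-DP.* The server starts with a model $w_0\in\mathbb R^n$ and $u_0=e_0=0\in\mathbb R^m$. In round $t=1,\dots,T_{\mathsf{cl}}$ every client is selected independently with probability $C$; let $\mathbb K$ be the set of selected present clients. Each $k\in\mathbb K$ runs a randomized local training (such as stochastic gradient descent) on $D_k$ starting at $w_{t-1}$, which produces a model $w_t^k$, and computes $c_t^k=\mathcal C(w_t^k-w_{t-1},m)$, the first $m$ coefficients of the orthonormal discrete cosine transform, and $\hat c_t^k=c_t^k/\max(1,\|c_t^k\|_2/S)$. It contributes $\hat c_t^k+z_k$ with an independent Gaussian vector $z_k$ in $\mathbb R^m$ with mean $0$ and standard deviation $S\sigma/\sqrt{|\mathbb K|}$ in each coordinate, so that the noise shares sum to Gaussian noise with standard deviation $S\sigma$ in each coordinate. Secure aggregation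 reveals only the sum $Y_t=\sum_{k\in\mathbb K}(\hat c_t^k+z_k)$; if $\mathbb K=\emptyset$, then $Y_t$ is Gaussian noise with mean $0$ and standard deviation $S\sigma$ in each coordinate. The server sets $u_t=\rho u_{t-1}+Y_t/(CN)$, $\tilde e_t=\eta_G u_t+e_{t-1}$, $s_t=\mathcal D(\tilde e_t)$, $e_t=\tilde e_t-\mathcal C(s_t,m)$ and $w_t=w_{t-1}+s_t$, where $\rho,\eta_G\in\mathbb R$ and $\mathcal D:\mathbb R^m\to\mathbb R^n$ is any measurable decompression map (such as a solver of the $\ell_1$-regularized least squares problem). Local training is any measurable function of the current model and of a random seed, with identically distributed seeds that are independent over clients and rounds; selections, seeds and noise are mutually independent. *Privacy.* For output laws $\mu,\nu$ of a mechanism $\mathcal A$ on $D,D'$ the privacy loss at an output $o$ is the logarithm of the ratio of the densities of $\mu$ and $\nu$ at $o$ (with respect to $\mu+\nu$). $\mathcal A$ is $(\varepsilon,\delta)$-differentially private if for all adjacent $D,D'$ the privacy loss of $\mathcal A(D)$ against $\mathcal A(D')$ at $o\sim\mathcal A(D)$ exceeds $\varepsilon$ with probability at most $\delta$. *Moments.*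 Let $\mathsf{pdf}_{\mathcal G(a,\xi)}$ be the density of the Gaussian law on $\mathbb R$ with mean $a$ and standard deviation $\xi$. With $\xi=\sigma$, put $\eta_0=\mathsf{pdf}_{\mathcal G(0,\xi)}$, $\eta_1=(1-C)\,\mathsf{pdf}_{\mathcal G(0,\xi)}+C\,\mathsf{pdf}_{\mathcal G(1,\xi)}$ and, for real $\lambda>0$, $$\alpha(\lambda\mid C)=\log\max\Bigl(\int_{\mathbb R}\eta_0\Bigl(\frac{\eta_0}{\eta_1}\Bigr)^{\lambda}dx,\ \int_{\mathbb R}\eta_1\Bigl(\frac{\eta_1}{\eta_0}\Bigr)^{\lambda}dx\Bigr).$$ **Theorem.** The minimum $$\varepsilon=\min_{\lambda>0}\frac{T_{\mathsf{cl}}\cdot\alpha(\lambda\mid C)-\log\delta}{\lambda}$$ exists, and FL-CS-DP is $(\varepsilon,\delta)$-differentially private at the client level. This holds both for the transcript $(Y_t,w_t)_{1\le t\le T_{\mathsf{cl}}}$ of all aggregates and models, and for the final model $w_{T_{\mathsf{cl}}}$ as the only output. -/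

import Mathlib

open MeasureTheory ProbabilityTheory
open scoped ENNReal

noncomputable section

namespace FLCSDP

/-! ## Differential privacy -/

/-- Privacy loss of output `o` for output laws `μ` (on `D`) and `ν` (on `D'`): the logarithm of the
ratio of their densities with respect to the common dominating measure `μ + ν`. It is `⊤` where
only the density of `μ` is positive. -/
def privacyLoss {O : Type*} [MeasurableSpace O] (μ ν : Measure O) (o : O) : EReal :=
  ENNReal.log (μ.rnDeriv (μ + ν) o / ν.rnDeriv (μ + ν) o)

/-- `(ε, δ)`-differential privacy of a randomized mechanism `A`, given by its output laws: for all
adjacent `D, D'`, the privacy loss exceeds `ε` with probability at most `δ` over `O ∼ A D`. -/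
def IsDP {𝒟 O : Type*} [MeasurableSpace O] (adj : 𝒟 → 𝒟 → Prop) (A : 𝒟 → Measure O)
    (ε δ : ℝ) : Prop :=
  ∀ D D', adj D D' → A D {o | (ε : EReal) < privacyLoss (A D) (A D') o} ≤ ENNReal.ofReal δ

/-- A federation of `N` client slots: slot `k` holds the whole local dataset of client `k`, or
`none` if that client does not take part. -/
abbrev Federation (N : ℕ) (X : Type*) := Fin N → Option X

/-- Client-level adjacency: equal, or one is obtained from the other by removing one client. -/
def Adjacent {N : ℕ} {X : Type*} (D D' : Federation N X) : Prop :=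
  D = D' ∨ ∃ j, (D j = none ∨ D' j = none) ∧ ∀ k, k ≠ j → D k = D' k

/-! ## The one-dimensional moments -/

/-- Density of the Gaussian law on `ℝ` with mean `a` and standard deviation `ξ`. -/
def gaussPdf (a ξ x : ℝ) : ℝ :=
  1 / (Real.sqrt (2 * Real.pi) * ξ) * Real.exp (-(x - a) ^ 2 / (2 * ξ ^ 2))

def eta0 (ξ x : ℝ) : ℝ := gaussPdf 0 ξ x

def eta1 (ξ C x : ℝ) : ℝ := (1 - C) * gaussPdf 0 ξ x + C * gaussPdf 1 ξ x

def E1 (l ξ C : ℝ) : ℝ := ∫ x, eta0 ξ x * (eta0 ξ x / eta1 ξ C x) ^ l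

def E2 (l ξ C : ℝ) : ℝ := ∫ x, eta1 ξ C x * (eta1 ξ C x / eta0 ξ x) ^ l

def alpha (l ξ C : ℝ) : ℝ := Real.log (max (E1 l ξ C) (E2 l ξ C))

/-! ## Compression and clipping -/

abbrev Vec (d : ℕ) := EuclideanSpace ℝ (Fin d)

/-- The first `m` rows of the orthonormal `n × n` matrix of the Discrete Cosine Transform. -/
def dctMatrix (m n : ℕ) : Matrix (Fin m) (Fin n) ℝ := fun i j =>
  (if (i : ℕ) = 0 then Real.sqrt (1 / n) else Real.sqrt (2 / n)) *
    Real.cos (Real.pi * (2 * (j : ℝ) + 1) * (i : ℝ) / (2 * n))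

/-- The compression operator: the first `m` DCT coefficients. -/
def compress (m : ℕ) {n : ℕ} (x : Vec n) : Vec m :=
  WithLp.toLp 2 ((dctMatrix m n).mulVec (WithLp.ofLp x))

/-- Clipping to Euclidean norm at most `S`. -/
def clip (S : ℝ) {m : ℕ} (c : Vec m) : Vec m := (max 1 (‖c‖ / S))⁻¹ • c

/-! ## The protocol -/

/-- The public parameters of a run with `N` client slots, model dimension `n`, compressed
dimension `m`, local datasets in `X` and random seeds of the local training in `Seed`. -/
structure Params (N n m : ℕ) (X Seed : Type*) where
  /-- sampling probability of a client in a round -/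
  C : ℝ
  /-- clipping threshold -/
  S : ℝ
  /-- noise multiplier -/
  σ : ℝ
  /-- momentum -/
  ρ : ℝ
  /-- global learning rate -/
  ηG : ℝ
  /-- initial model -/
  w0 : Vec n
  /-- local training: the model that a client obtains from its dataset, the current model and the
  seed from which the training draws its random batches -/
  sgd : X → Vec n → Seed → Vec n
  /-- decompression of the accumulated compressed error -/
  decompress : Vec m → Vec n

/-- Randomness of one client in one round: whether the client is selected, its training seed, and
a standard Gaussian vector for its noise share. -/
abbrev ClientRand (m : ℕ) (Seed : Type*) := Bool × Seed × Vec m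

/-- Randomness of one round: that of every client, and a standard Gaussian vector that is used only
if no participating client is selected. -/
abbrev RoundRand (N m : ℕ) (Seed : Type*) := (Fin N → ClientRand m Seed) × Vec m

/-- Server state: model `w`, momentum `u` and error `e`. -/
abbrev ServerState (n m : ℕ) := Vec n × Vec m × Vec m

/-- What is revealed over `T` rounds: the securely aggregated noisy sum and the new model of every
round. -/
abbrev Transcript (T n m : ℕ) := Fin T → Vec m × Vec n

variable {N n m : ℕ} {X Seed : Type*}

/-- The participating clients that are selected in a round. -/
def selected (D : Federation N X) (r : RoundRand N m Seed) : Finset (Fin N) :=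
  Finset.univ.filter fun k => (D k).isSome = true ∧ (r.1 k).1 = true

/-- The clipped compressed update of a client with dataset `x`, current model `w` and seed `s`. -/
def clippedUpdate (P : Params N n m X Seed) (x : X) (w : Vec n) (s : Seed) : Vec m :=
  clip P.S (compress m (P.sgd x w s - w))

/-- The noisy sum which secure aggregation reveals to the server. With `K` the set of selected
clients, each one contributes its clipped compressed update and a Gaussian noise share of standard
deviation `S σ / √|K|` per coordinate, so that the noise shares sum to standard deviation `S σ`.
If `K` is empty, the aggregate consists of noise of standard deviation `S σ`. -/
def aggregate (P : Params N n m X Seed) (D : Federation N X) (w : Vec n)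
    (r : RoundRand N m Seed) : Vec m :=
  if selected D r = ∅ then (P.S * P.σ) • r.2
  else ∑ k ∈ selected D r,
    ((D k).elim 0 (fun x => clippedUpdate P x w (r.1 k).2.1) +
      (P.S * P.σ / Real.sqrt ((selected D r).card : ℝ)) • (r.1 k).2.2)

/-- The server's update from the aggregate `y`: averaging (over the nominal number `C N` of clients
per round), momentum, error feedback, reconstruction, error accumulation and model update. -/
def serverStep (P : Params N n m X Seed) (s : ServerState n m) (y : Vec m) : ServerState n m :=
  let u := P.ρ • s.2.1 + (P.C * N)⁻¹ • y
  let e := P.ηG • u + s.2.2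
  let d := P.decompress e
  (s.1 + d, u, e - compress m d)

/-- `T` rounds of the protocol as a function of its randomness: the final server state and the
transcript. -/
def run (P : Params N n m X Seed) (D : Federation N X) :
    (T : ℕ) → (Fin T → RoundRand N m Seed) → ServerState n m × Transcript T n m
  | 0, _ => ((P.w0, 0, 0), Fin.elim0)
  | T + 1, r =>
    let prev := run P D T (Fin.init r)
    let y := aggregate P D prev.1.1 (r (Fin.last T))
    let s := serverStep P prev.1 y
    (s, Fin.snoc prev.2 (y, s.1))

theorem continuous_compress (m n : ℕ) : Continuous (compress m : Vec n → Vec m) := by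
  unfold compress
  fun_prop

theorem measurable_clip (S : ℝ) (m : ℕ) : Measurable (clip S : Vec m → Vec m) := by
  unfold clip
  fun_prop

theorem measurable_serverStep (P : Params N n m X Seed) (hdec : Measurable P.decompress) :
    Measurable fun p : ServerState n m × Vec m => serverStep P p.1 p.2 := by
  have hc := (continuous_compress m n).measurable
  unfold serverStep
  fun_prop

variable [MeasurableSpace Seed]

/-- Law of a client's randomness: selection with probability `C`, seed, standard Gaussian vector,
all independent. -/
def clientLaw (m : ℕ) (C : ℝ) (seedLaw : Measure Seed) : Measure (ClientRand m Seed) :=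
  (ENNReal.ofReal C • Measure.dirac true + ENNReal.ofReal (1 - C) • Measure.dirac false).prod
    (seedLaw.prod (stdGaussian (Vec m)))

/-- Law of the randomness of a round: all clients are independent. -/
def roundLaw (N m : ℕ) (C : ℝ) (seedLaw : Measure Seed) : Measure (RoundRand N m Seed) :=
  (Measure.pi fun _ : Fin N => clientLaw m C seedLaw).prod (stdGaussian (Vec m))

/-- Law of the randomness of `T` independent rounds. -/
def runLaw (N m : ℕ) (C : ℝ) (seedLaw : Measure Seed) (T : ℕ) :
    Measure (Fin T → RoundRand N m Seed) :=
  Measure.pi fun _ => roundLaw N m C seedLaw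

/-- The mechanism: the law of the transcript of `T` rounds on the federation `D`. -/
def transcriptLaw (P : Params N n m X Seed) (seedLaw : Measure Seed) (T : ℕ)
    (D : Federation N X) : Measure (Transcript T n m) :=
  (runLaw N m P.C seedLaw T).map fun r => (run P D T r).2

/-- The law of the global model after `T` rounds on the federation `D`. -/
def outputLaw (P : Params N n m X Seed) (seedLaw : Measure Seed) (T : ℕ)
    (D : Federation N X) : Measure (Vec n) :=
  (runLaw N m P.C seedLaw T).map fun r => (run P D T r).1.1

/-! ## The laws above are probability measures -/

theorem measurable_clippedUpdate (P : Params N n m X Seed) (x : X)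
    (hsgd : Measurable fun p : Vec n × Seed => P.sgd x p.1 p.2) :
    Measurable fun p : Vec n × Seed => clippedUpdate P x p.1 p.2 :=
  (measurable_clip P.S m).comp
    ((continuous_compress m n).measurable.comp (hsgd.sub measurable_fst))

theorem measurable_aggregate (P : Params N n m X Seed) (D : Federation N X)
    (hsgd : ∀ x, Measurable fun p : Vec n × Seed => P.sgd x p.1 p.2) :
    Measurable fun p : Vec n × RoundRand N m Seed => aggregate P D p.1 p.2 := by
  classical
  -- For a fixed value of the selection bits the aggregate is visibly measurable.
  let f : (Fin N → Bool) → Vec n × RoundRand N m Seed → Vec m := fun b p =>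
    if (Finset.univ.filter fun k => (D k).isSome = true ∧ b k = true) = ∅
      then (P.S * P.σ) • p.2.2
    else ∑ k ∈ Finset.univ.filter fun k => (D k).isSome = true ∧ b k = true,
      ((D k).elim 0 (fun x => clippedUpdate P x p.1 (p.2.1 k).2.1) +
        (P.S * P.σ / Real.sqrt
          (((Finset.univ.filter fun k => (D k).isSome = true ∧ b k = true).card : ℕ) : ℝ)) •
          (p.2.1 k).2.2)
  have hf : ∀ b, Measurable (f b) := by
    intro b
    by_cases h : (Finset.univ.filter fun k => (D k).isSome = true ∧ b k = true) = ∅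
    · simp only [f, h, if_true]
      fun_prop
    · simp only [f, h, if_false]
      refine Finset.measurable_fun_sum _ fun k _ => Measurable.add ?_ (by fun_prop)
      cases D k with
      | none => exact measurable_const
      | some x =>
        exact (measurable_clippedUpdate P x (hsgd x)).comp
          (g := fun p : Vec n × Seed => clippedUpdate P x p.1 p.2)
          (f := fun p : Vec n × RoundRand N m Seed => (p.1, (p.2.1 k).2.1)) (by fun_prop)
  have h2 : Measurable fun q : (Fin N → Bool) × (Vec n × RoundRand N m Seed) => f q.1 q.2 :=
    measurable_from_prod_countable_right hf
  exact h2.comp (g := fun q : (Fin N → Bool) × (Vec n × RoundRand N m Seed) => f q.1 q.2)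
    (f := fun p : Vec n × RoundRand N m Seed => ((fun k => (p.2.1 k).1), p)) (by fun_prop)

theorem measurable_run (P : Params N n m X Seed) (D : Federation N X)
    (hsgd : ∀ x, Measurable fun p : Vec n × Seed => P.sgd x p.1 p.2)
    (hdec : Measurable P.decompress) (T : ℕ) : Measurable (run P D T) := by
  induction T with
  | zero => exact measurable_const
  | succ T ih =>
    have h1 : Measurable fun r : Fin (T + 1) → RoundRand N m Seed =>
        run P D T (Fin.init r) :=
      ih.comp (measurable_pi_lambda _ fun i => measurable_pi_apply _)
    have h2 : Measurable fun r : Fin (T + 1) → RoundRand N m Seed =>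
        aggregate P D (run P D T (Fin.init r)).1.1 (r (Fin.last T)) :=
      (measurable_aggregate P D hsgd).comp (h1.fst.fst.prodMk (measurable_pi_apply _))
    have h3 : Measurable fun r : Fin (T + 1) → RoundRand N m Seed =>
        serverStep P (run P D T (Fin.init r)).1
          (aggregate P D (run P D T (Fin.init r)).1.1 (r (Fin.last T))) :=
      (measurable_serverStep P hdec).comp (h1.fst.prodMk h2)
    refine h3.prodMk (measurable_pi_lambda _ fun i => ?_)
    refine Fin.lastCases ?_ (fun i => ?_) i
    · simp only [Fin.snoc_last]
      exact h2.prodMk h3.fst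
    · simp only [Fin.snoc_castSucc]
      exact (measurable_pi_apply i).comp h1.snd

theorem isProbabilityMeasure_runLaw {C : ℝ} (hC0 : 0 ≤ C) (hC1 : C ≤ 1) (seedLaw : Measure Seed)
    [IsProbabilityMeasure seedLaw] (T : ℕ) :
    IsProbabilityMeasure (runLaw N m C seedLaw T) := by
  have h : IsProbabilityMeasure
      (ENNReal.ofReal C • Measure.dirac true + ENNReal.ofReal (1 - C) • Measure.dirac false :
        Measure Bool) := by
    constructor
    simp only [Measure.add_apply, Measure.smul_apply, measure_univ, smul_eq_mul, mul_one]
    rw [← ENNReal.ofReal_add hC0 (by linarith)]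
    simp
  unfold runLaw roundLaw clientLaw
  infer_instance

end FLCSDP

end

/-! Fix adjacent federations, with client `j` present in `D` and absent in `D'`. Given the current
model, the seeds and the other selection bits, one round gives `u + S σ g` on `D'` and the same plus
`b S v` on `D`. Here `b` is the selection bit of `j`, `g` is standard Gaussian, and `v` is the
clipped update divided by `S`, so `‖v‖ ≤ 1`. Since `1 - v vᵀ` is then positive semidefinite, `σ g`
can be generated as `z v + σ h`, with `z` a real Gaussian of standard deviation `σ` and `h`
independent of covariance `1 - v vᵀ`. Hence both aggregates are the same function (`simulate`) of a
real number and shared independent randomness: the number is `z` for `D'` and `b + z`, a sample of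
the mixture, for `D`. Short directions need no separate monotonicity argument.

As the direction may depend on the current model, this survives adaptive composition: the whole run
is one fixed measurable map applied to `T` independent copies of the pair (real number, shared
randomness) (`map_runWith_congr`, `measure_lt_privacyLoss_run_le`). Under the product law the
likelihood ratio is a product of one-dimensional ratios, so its moments are `T`-th powers of the
moments in `alpha`.

On the event that the loss exceeds `ε`, the first law is at least `exp ε` times the second. This
inequality pulls back along the map, and Hölder's inequality upstairs bounds the event by `exp (T α
- l ε)` (`withDensity_apply_le_moment`), so postprocessing costs nothing. At the minimizing `l` this
bound is `δ`. The minimum is attained because the objective is continuous and exceeds its value at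
`1` near `0` and near infinity (`exists_isMin_bound`). -/

noncomputable section

namespace FLCSDP

/-! ## Moment bounds for the privacy loss -/

section Tail

variable {α β O : Type*} [MeasurableSpace α] [MeasurableSpace β] [MeasurableSpace O]

/-- By Hölder's inequality, an event that is `exp ε` times more likely under the measure of density
`f` than under `ν` has a small measure, in terms of the moments of `f`. -/
theorem withDensity_apply_le_moment (ν : Measure α) {f : α → ℝ≥0∞} (hf : Measurable f)
    {A : Set α} (hA : MeasurableSet A) (hfin : ν.withDensity f A ≠ ⊤) {l ε : ℝ} (hl : 0 < l)
    (h : ENNReal.ofReal (Real.exp ε) * ν A ≤ ν.withDensity f A) :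
    ν.withDensity f A ≤ ENNReal.ofReal (Real.exp (-l * ε)) * ∫⁻ x, f x ^ (l + 1) ∂ν := by
  set a := ν.withDensity f A with ha
  set M := ∫⁻ x, f x ^ (l + 1) ∂ν
  rcases eq_or_ne a 0 with h0 | h0
  · simp [h0]
  have hpq : (l + 1).HolderConjugate ((l + 1) / l) := by
    refine (Real.holderConjugate_iff).2 ⟨by linarith, ?_⟩
    field_simp
    ring
  have h1 : a ≤ M ^ (1 / (l + 1)) * ν A ^ (l / (l + 1)) := by
    have := ENNReal.lintegral_mul_le_Lp_mul_Lq ν hpq hf.aemeasurable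
      ((measurable_const (a := (1 : ℝ≥0∞))).indicator hA).aemeasurable
    have e1 : ∫⁻ x, (f * A.indicator fun _ => (1 : ℝ≥0∞)) x ∂ν = a := by
      rw [ha, withDensity_apply _ hA, ← lintegral_indicator hA]
      refine lintegral_congr fun x => ?_
      by_cases hx : x ∈ A <;> simp [hx]
    have e2 : ∫⁻ x, (A.indicator (fun _ => (1 : ℝ≥0∞)) x) ^ ((l + 1) / l) ∂ν = ν A := by
      rw [← lintegral_indicator_one hA]
      refine lintegral_congr fun x => ?_
      by_cases hx : x ∈ A
      · simp [hx]
      · simp [hx, show 0 < (l + 1) / l by positivity]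
    rwa [e1, e2, one_div_div] at this
  have h2 : a ^ (l + 1) ≤ M * ν A ^ l := by
    calc a ^ (l + 1) ≤ (M ^ (1 / (l + 1)) * ν A ^ (l / (l + 1))) ^ (l + 1) :=
          ENNReal.rpow_le_rpow h1 (by positivity)
      _ = M * ν A ^ l := by
          rw [ENNReal.mul_rpow_of_nonneg _ _ (by positivity), ← ENNReal.rpow_mul,
            ← ENNReal.rpow_mul, one_div_mul_cancel (by positivity),
            div_mul_cancel₀ _ (by positivity), ENNReal.rpow_one]
  have h3 : ν A ≤ ENNReal.ofReal (Real.exp (-ε)) * a := by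
    calc ν A = ENNReal.ofReal (Real.exp (-ε)) * (ENNReal.ofReal (Real.exp ε) * ν A) := by
          rw [← mul_assoc, ← ENNReal.ofReal_mul (Real.exp_pos _).le, ← Real.exp_add]
          simp
      _ ≤ _ := by gcongr
  -- Combining `h2` and `h3` leaves a common factor `a ^ l`, which may be cancelled because `a` is
  -- neither `0` nor `⊤`.
  have h4 : a ^ l * a ≤ a ^ l * (ENNReal.ofReal (Real.exp (-l * ε)) * M) := by
    calc a ^ l * a = a ^ (l + 1) := by
          rw [ENNReal.rpow_add _ _ h0 hfin, ENNReal.rpow_one]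
      _ ≤ M * (ENNReal.ofReal (Real.exp (-ε)) * a) ^ l := by
          refine h2.trans ?_
          gcongr
      _ = _ := by
          rw [ENNReal.mul_rpow_of_nonneg _ _ hl.le,
            ENNReal.ofReal_rpow_of_pos (Real.exp_pos _), ← Real.exp_mul,
            show -ε * l = -l * ε by ring]
          ring
  exact (ENNReal.mul_le_mul_iff_right (by simp [ENNReal.rpow_eq_zero_iff, h0, hfin])
    (ENNReal.rpow_ne_top_of_nonneg hl.le hfin)).1 h4

theorem measurable_privacyLoss (μ ν : Measure O) : Measurable (privacyLoss μ ν) :=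
  ENNReal.measurable_log.comp ((Measure.measurable_rnDeriv _ _).div (Measure.measurable_rnDeriv _ _))

theorem measurableSet_lt_privacyLoss (μ ν : Measure O) (ε : ℝ) :
    MeasurableSet {o | (ε : EReal) < privacyLoss μ ν o} :=
  measurableSet_lt measurable_const (measurable_privacyLoss μ ν)

/-- Where the privacy loss exceeds `ε`, the first law is at least `exp ε` times the second. -/
theorem exp_mul_measure_lt_privacyLoss_le (μ ν : Measure O) [IsFiniteMeasure μ]
    [IsFiniteMeasure ν] (ε : ℝ) :
    ENNReal.ofReal (Real.exp ε) * ν {o | (ε : EReal) < privacyLoss μ ν o} ≤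
      μ {o | (ε : EReal) < privacyLoss μ ν o} := by
  set B := {o | (ε : EReal) < privacyLoss μ ν o} with hB
  have hBm : MeasurableSet B := measurableSet_lt_privacyLoss μ ν ε
  have hμ : μ ≪ μ + ν := Measure.absolutelyContinuous_of_le (Measure.le_add_right le_rfl)
  have hν : ν ≪ μ + ν := Measure.absolutelyContinuous_of_le (Measure.le_add_left le_rfl)
  rw [← Measure.setLIntegral_rnDeriv hμ, ← Measure.setLIntegral_rnDeriv hν,
    ← lintegral_const_mul _ (Measure.measurable_rnDeriv _ _)]
  refine setLIntegral_mono (Measure.measurable_rnDeriv _ _) fun o ho => ?_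
  have h1 : ENNReal.ofReal (Real.exp ε) < μ.rnDeriv (μ + ν) o / ν.rnDeriv (μ + ν) o := by
    have h2 : ENNReal.log (ENNReal.ofReal (Real.exp ε)) <
        ENNReal.log (μ.rnDeriv (μ + ν) o / ν.rnDeriv (μ + ν) o) := by
      rw [ENNReal.log_ofReal_of_pos (Real.exp_pos _), Real.log_exp]
      exact ho
    exact ENNReal.log_lt_log_iff.1 h2
  exact ENNReal.mul_le_of_le_div h1.le

/-- Moment bound for the privacy loss of two images of measures under the same map. -/
theorem measure_lt_privacyLoss_map_le (ν : Measure α) [IsFiniteMeasure ν] {f : α → ℝ≥0∞}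
    (hf : Measurable f) [IsFiniteMeasure (ν.withDensity f)] {Φ : α → O} (hΦ : Measurable Φ)
    {l : ℝ} (hl : 0 < l) (ε : ℝ) :
    ((ν.withDensity f).map Φ)
        {o | (ε : EReal) < privacyLoss ((ν.withDensity f).map Φ) (ν.map Φ) o} ≤
      ENNReal.ofReal (Real.exp (-l * ε)) * ∫⁻ x, f x ^ (l + 1) ∂ν := by
  have hB := measurableSet_lt_privacyLoss ((ν.withDensity f).map Φ) (ν.map Φ) ε
  have h := exp_mul_measure_lt_privacyLoss_le ((ν.withDensity f).map Φ) (ν.map Φ) ε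
  -- The comparison of the two images on the loss event is a comparison of the original measures on
  -- its preimage, where the density `f` is explicit.
  rw [Measure.map_apply hΦ hB, Measure.map_apply hΦ hB] at h
  rw [Measure.map_apply hΦ hB]
  exact withDensity_apply_le_moment ν hf (hΦ hB) (measure_ne_top _ _) hl h

theorem lintegral_pi_prod_eq_prod {ι : Type*} [Fintype ι] (ν : ι → Measure α)
    [∀ i, IsProbabilityMeasure (ν i)] {f : ι → α → ℝ≥0∞} (hf : ∀ i, Measurable (f i)) :
    ∫⁻ x, ∏ i, f i (x i) ∂(Measure.pi ν) = ∏ i, ∫⁻ x, f i x ∂(ν i) := by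
  have hind : iIndepFun (fun i (x : ι → α) => f i (x i)) (Measure.pi ν) :=
    iIndepFun_pi fun i => (hf i).aemeasurable
  rw [lintegral_prod_eq_prod_lintegral_of_indepFun Finset.univ _ hind
    fun i => (hf i).comp (measurable_pi_apply i)]
  refine Finset.prod_congr rfl fun i _ => ?_
  exact (measurePreserving_eval ν i).lintegral_comp (hf i)

/-- A product measure is determined by its values on boxes, and the indicator of a box times a
product density is again a product of functions of single coordinates. -/
theorem pi_withDensity {ι : Type*} [Fintype ι] (ν : ι → Measure α)
    [∀ i, IsProbabilityMeasure (ν i)] {f : ι → α → ℝ≥0∞} (hf : ∀ i, Measurable (f i))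
    [∀ i, SigmaFinite ((ν i).withDensity (f i))] :
    Measure.pi (fun i => (ν i).withDensity (f i)) =
      (Measure.pi ν).withDensity fun x => ∏ i, f i (x i) := by
  refine Measure.pi_eq fun s hs => ?_
  rw [withDensity_apply _ (MeasurableSet.univ_pi hs), ← lintegral_indicator (MeasurableSet.univ_pi hs)]
  have e : ∀ x : ι → α, (Set.univ.pi s).indicator (fun x => ∏ i, f i (x i)) x =
      ∏ i, (s i).indicator (f i) (x i) := by
    intro x
    by_cases hx : x ∈ Set.univ.pi s
    · rw [Set.indicator_of_mem hx]
      exact Finset.prod_congr rfl fun i _ => (Set.indicator_of_mem (hx i trivial) _).symm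
    · rw [Set.indicator_of_notMem hx]
      simp only [Set.mem_pi, Set.mem_univ, true_implies, not_forall] at hx
      obtain ⟨i, hi⟩ := hx
      exact (Finset.prod_eq_zero (Finset.mem_univ i) (Set.indicator_of_notMem hi _)).symm
  simp_rw [e]
  rw [lintegral_pi_prod_eq_prod ν fun i => (hf i).indicator (hs i)]
  exact Finset.prod_congr rfl fun i _ => by
    rw [lintegral_indicator (hs i), withDensity_apply _ (hs i)]

end Tail

/-! ## The Gaussian mixture -/

/-- The centered Gaussian law on `ℝ` with standard deviation `σ`. -/
def noiseLaw (σ : ℝ) : Measure ℝ := gaussianReal 0 (Real.toNNReal (σ ^ 2))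

instance (σ : ℝ) : IsProbabilityMeasure (noiseLaw σ) := by unfold noiseLaw; infer_instance

/-- The likelihood ratio of the mixture `(1 - C) 𝒢(0, σ) + C 𝒢(1, σ)` and `𝒢(0, σ)`. -/
def likelihood (σ C x : ℝ) : ℝ := 1 - C + C * Real.exp ((2 * x - 1) / (2 * σ ^ 2))

/-- The moments of the likelihood ratio. -/
def moment (σ C l : ℝ) : ℝ := ∫ x, likelihood σ C x ^ l ∂(noiseLaw σ)

theorem measurable_likelihood (σ C : ℝ) : Measurable (likelihood σ C) := by
  unfold likelihood; fun_prop

theorem likelihood_pos {σ C : ℝ} (hC0 : 0 < C) (hC1 : C ≤ 1) (x : ℝ) : 0 < likelihood σ C x := by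
  unfold likelihood
  have := mul_pos hC0 (Real.exp_pos ((2 * x - 1) / (2 * σ ^ 2)))
  linarith

theorem gaussPdf_eq {σ : ℝ} (hσ : 0 < σ) (a x : ℝ) :
    gaussPdf a σ x = gaussianPDFReal a (Real.toNNReal (σ ^ 2)) x := by
  rw [gaussPdf, gaussianPDFReal, Real.coe_toNNReal _ (sq_nonneg σ), one_div,
    Real.sqrt_mul (by positivity) (σ ^ 2), Real.sqrt_sq hσ.le]

theorem gaussPdf_pos {σ : ℝ} (hσ : 0 < σ) (a x : ℝ) : 0 < gaussPdf a σ x := by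
  unfold gaussPdf
  positivity

theorem gaussPdf_one {σ : ℝ} (hσ : 0 < σ) (x : ℝ) :
    gaussPdf 1 σ x = gaussPdf 0 σ x * Real.exp ((2 * x - 1) / (2 * σ ^ 2)) := by
  unfold gaussPdf
  rw [mul_assoc, ← Real.exp_add]
  congr 2
  field_simp
  ring

theorem eta1_eq {σ : ℝ} (hσ : 0 < σ) (C x : ℝ) :
    eta1 σ C x = gaussPdf 0 σ x * likelihood σ C x := by
  rw [eta1, likelihood, gaussPdf_one hσ]
  ring

theorem noiseLaw_eq {σ : ℝ} (hσ : 0 < σ) :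
    noiseLaw σ = volume.withDensity fun x => ENNReal.ofReal (gaussPdf 0 σ x) := by
  rw [noiseLaw, gaussianReal_of_var_ne_zero _ (by simp [hσ.ne'])]
  congr 1
  ext x
  rw [gaussPdf_eq hσ]; rfl

theorem measurable_gaussPdf (a σ : ℝ) : Measurable (gaussPdf a σ) := by
  unfold gaussPdf; fun_prop

theorem integral_noiseLaw {σ : ℝ} (hσ : 0 < σ) (g : ℝ → ℝ) :
    ∫ x, g x ∂(noiseLaw σ) = ∫ x, gaussPdf 0 σ x * g x := by
  rw [noiseLaw_eq hσ, integral_withDensity_eq_integral_toReal_smul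
    (measurable_gaussPdf 0 σ).ennreal_ofReal (by simp)]
  refine integral_congr_ae (.of_forall fun x => ?_)
  simp [ENNReal.toReal_ofReal (gaussPdf_pos hσ 0 x).le]

/-- With `η₁ = η₀ L`, both integrals become moments of the one function `L` under the one law
`noiseLaw`, of orders `-l` and `l + 1`. -/
theorem E1_eq {σ C : ℝ} (hσ : 0 < σ) (hC0 : 0 < C) (hC1 : C ≤ 1) (l : ℝ) :
    E1 l σ C = moment σ C (-l) := by
  rw [E1, moment, integral_noiseLaw hσ]
  refine integral_congr_ae (.of_forall fun x => ?_)
  have hL := likelihood_pos (σ := σ) hC0 hC1 x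
  have hg := gaussPdf_pos hσ 0 x
  simp only [eta0]
  rw [eta1_eq hσ, div_mul_cancel_left₀ hg.ne', Real.rpow_neg hL.le, Real.inv_rpow hL.le]

theorem E2_eq {σ C : ℝ} (hσ : 0 < σ) (hC0 : 0 < C) (hC1 : C ≤ 1) (l : ℝ) :
    E2 l σ C = moment σ C (l + 1) := by
  rw [E2, moment, integral_noiseLaw hσ]
  refine integral_congr_ae (.of_forall fun x => ?_)
  have hL := likelihood_pos (σ := σ) hC0 hC1 x
  have hg := gaussPdf_pos hσ 0 x
  simp only [eta0]
  rw [eta1_eq hσ, mul_div_cancel_left₀ _ hg.ne', Real.rpow_add hL, Real.rpow_one]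
  ring

theorem integrable_exp_mul_noiseLaw (σ a b : ℝ) :
    Integrable (fun x => Real.exp (a * x + b)) (noiseLaw σ) := by
  simp_rw [Real.exp_add]
  exact (integrable_exp_mul_gaussianReal a).mul_const _

/-- With `y` the exponential in the likelihood, `C y ≤ L ≤ 2 max 1 y`. The upper bound serves `l ≥
0` and the lower one `l ≤ 0`; either way a constant plus an exponential of an affine function
dominates. -/
theorem integrable_likelihood_rpow {σ C : ℝ} (hC0 : 0 < C) (hC1 : C ≤ 1) (l : ℝ) :
    Integrable (fun x => likelihood σ C x ^ l) (noiseLaw σ) := by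
  set k := 1 / (2 * σ ^ 2)
  have hexp : ∀ x, (2 * x - 1) / (2 * σ ^ 2) = k * (2 * x - 1) := fun x => by
    simp only [k]; ring
  rcases le_total 0 l with hl | hl
  · have hb : Integrable (fun x => (2 : ℝ) ^ l * (1 + Real.exp (l * k * 2 * x + -(l * k))))
        (noiseLaw σ) :=
      ((integrable_const 1).add (integrable_exp_mul_noiseLaw σ _ _)).const_mul _
    refine hb.mono' ((measurable_likelihood σ C).pow_const l).aestronglyMeasurable
      (.of_forall fun x => ?_)
    have hL := likelihood_pos (σ := σ) hC0 hC1 x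
    rw [Real.norm_of_nonneg (Real.rpow_nonneg hL.le _)]
    set y := Real.exp ((2 * x - 1) / (2 * σ ^ 2)) with hy
    have hy0 : 0 < y := Real.exp_pos _
    have hle : likelihood σ C x ≤ 2 * max 1 y := by
      have h1 := le_max_left 1 y
      have h2 := le_max_right 1 y
      have : likelihood σ C x = 1 - C + C * y := rfl
      nlinarith
    calc likelihood σ C x ^ l ≤ (2 * max 1 y) ^ l := Real.rpow_le_rpow hL.le hle hl
      _ = 2 ^ l * (max 1 y) ^ l := Real.mul_rpow (by norm_num) (by positivity)
      _ ≤ 2 ^ l * (1 + y ^ l) := by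
          gcongr
          rcases le_total 1 y with h | h
          · rw [max_eq_right h]; linarith
          · rw [max_eq_left h, Real.one_rpow]; linarith [Real.rpow_nonneg hy0.le l]
      _ = _ := by
          rw [hy, ← Real.exp_mul, hexp]
          congr 3
          ring
  · have hb : Integrable (fun x => C ^ l * Real.exp (l * k * 2 * x + -(l * k))) (noiseLaw σ) :=
      (integrable_exp_mul_noiseLaw σ _ _).const_mul _
    refine hb.mono' ((measurable_likelihood σ C).pow_const l).aestronglyMeasurable
      (.of_forall fun x => ?_)
    have hL := likelihood_pos (σ := σ) hC0 hC1 x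
    rw [Real.norm_of_nonneg (Real.rpow_nonneg hL.le _)]
    have hle : C * Real.exp ((2 * x - 1) / (2 * σ ^ 2)) ≤ likelihood σ C x := by
      unfold likelihood; linarith
    calc likelihood σ C x ^ l ≤ (C * Real.exp ((2 * x - 1) / (2 * σ ^ 2))) ^ l :=
          Real.rpow_le_rpow_of_nonpos (by positivity) hle hl
      _ = _ := by
          rw [Real.mul_rpow hC0.le (Real.exp_pos _).le, ← Real.exp_mul, hexp]
          congr 2
          ring

/-- The moment is the moment generating function of `log L`, which is finite on the whole line and
therefore continuous. -/
theorem continuous_moment {σ C : ℝ} (hC0 : 0 < C) (hC1 : C ≤ 1) :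
    Continuous (moment σ C) := by
  have e : ∀ l x, likelihood σ C x ^ l = Real.exp (l * Real.log (likelihood σ C x)) :=
    fun l x => by rw [Real.rpow_def_of_pos (likelihood_pos hC0 hC1 x), mul_comm]
  have h : moment σ C = mgf (fun x => Real.log (likelihood σ C x)) (noiseLaw σ) := by
    ext l
    simp only [moment, mgf, e]
  rw [h]
  refine continuous_mgf fun t => ?_
  simpa only [e] using integrable_likelihood_rpow (σ := σ) hC0 hC1 t

theorem lintegral_likelihood_rpow {σ C : ℝ} (hC0 : 0 < C) (hC1 : C ≤ 1) (l : ℝ) :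
    ∫⁻ x, ENNReal.ofReal (likelihood σ C x) ^ l ∂(noiseLaw σ) =
      ENNReal.ofReal (moment σ C l) := by
  rw [moment, ofReal_integral_eq_lintegral_ofReal (integrable_likelihood_rpow hC0 hC1 l)
    (.of_forall fun x => Real.rpow_nonneg (likelihood_pos hC0 hC1 x).le _)]
  exact lintegral_congr fun x => ENNReal.ofReal_rpow_of_pos (likelihood_pos hC0 hC1 x)

/-- The mixture `(1 - C) 𝒢(0, σ) + C 𝒢(1, σ)`. -/
def mixtureLaw (σ C : ℝ) : Measure ℝ :=
  (noiseLaw σ).withDensity fun x => ENNReal.ofReal (likelihood σ C x)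

theorem shifted_noiseLaw {σ : ℝ} (hσ : 0 < σ) :
    (noiseLaw σ).map (fun y => 1 + y) =
      (noiseLaw σ).withDensity fun x => ENNReal.ofReal (Real.exp ((2 * x - 1) / (2 * σ ^ 2))) := by
  have hm : Measurable fun x : ℝ => Real.exp ((2 * x - 1) / (2 * σ ^ 2)) := by fun_prop
  rw [noiseLaw, gaussianReal_map_const_add, zero_add, ← noiseLaw, noiseLaw_eq hσ,
    gaussianReal_of_var_ne_zero _ (by simp [hσ.ne']),
    ← withDensity_mul _ (measurable_gaussPdf 0 σ).ennreal_ofReal hm.ennreal_ofReal]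
  congr 1
  ext x
  rw [gaussianPDF, ← gaussPdf_eq hσ, gaussPdf_one hσ, ENNReal.ofReal_mul (gaussPdf_pos hσ 0 x).le]
  rfl

/-- Links the density form, used for the moments, to the sampling form, used for the protocol. -/
theorem mixtureLaw_eq {σ C : ℝ} (hσ : 0 < σ) (hC0 : 0 < C) (hC1 : C ≤ 1) :
    mixtureLaw σ C = ENNReal.ofReal (1 - C) • noiseLaw σ +
      ENNReal.ofReal C • (noiseLaw σ).map (fun y => 1 + y) := by
  have hm : Measurable fun x : ℝ => ENNReal.ofReal (Real.exp ((2 * x - 1) / (2 * σ ^ 2))) := by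
    fun_prop
  rw [shifted_noiseLaw hσ, ← withDensity_smul _ hm]
  have : ENNReal.ofReal (1 - C) • noiseLaw σ =
      (noiseLaw σ).withDensity fun _ => ENNReal.ofReal (1 - C) := by rw [withDensity_const]
  rw [this, ← withDensity_add_left measurable_const, mixtureLaw]
  congr 1
  ext x
  simp only [likelihood, Pi.add_apply, Pi.smul_apply, smul_eq_mul]
  rw [ENNReal.ofReal_add (by linarith) (by positivity), ENNReal.ofReal_mul hC0.le]

theorem isProbabilityMeasure_mixtureLaw {σ C : ℝ} (hσ : 0 < σ) (hC0 : 0 < C) (hC1 : C ≤ 1) :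
    IsProbabilityMeasure (mixtureLaw σ C) := by
  have := Measure.isProbabilityMeasure_map (μ := noiseLaw σ) (f := fun y => 1 + y) (by fun_prop)
  constructor
  rw [mixtureLaw_eq hσ hC0 hC1]
  simp only [Measure.add_apply, Measure.smul_apply, measure_univ, smul_eq_mul, mul_one]
  rw [← ENNReal.ofReal_add (by linarith) hC0.le]
  simp

theorem noiseLaw_eq_withDensity_mixtureLaw {σ C : ℝ} (hC0 : 0 < C) (hC1 : C ≤ 1) :
    noiseLaw σ = (mixtureLaw σ C).withDensity fun x => (ENNReal.ofReal (likelihood σ C x))⁻¹ := by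
  rw [mixtureLaw]
  refine (withDensity_inv_same (measurable_likelihood σ C).ennreal_ofReal
    (.of_forall fun x => ?_) (.of_forall fun x => ENNReal.ofReal_ne_top)).symm
  simpa using likelihood_pos hC0 hC1 x

/-- Passing from the mixture to the noise law costs one factor `L`, and `L * L ^ (-(l + 1)) = L ^
(-l)`. -/
theorem lintegral_inv_likelihood_rpow {σ C : ℝ} (hC0 : 0 < C) (hC1 : C ≤ 1) (l : ℝ) :
    ∫⁻ x, (ENNReal.ofReal (likelihood σ C x))⁻¹ ^ (l + 1) ∂(mixtureLaw σ C) =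
      ENNReal.ofReal (moment σ C (-l)) := by
  have hm := (measurable_likelihood σ C).ennreal_ofReal
  have hi : Measurable fun x => (ENNReal.ofReal (likelihood σ C x))⁻¹ ^ (l + 1) :=
    hm.inv.pow_const _
  rw [mixtureLaw, lintegral_withDensity_eq_lintegral_mul _ hm hi,
    ← lintegral_likelihood_rpow hC0 hC1]
  refine lintegral_congr fun x => ?_
  have hL := likelihood_pos (σ := σ) hC0 hC1 x
  have h0 : ENNReal.ofReal (likelihood σ C x) ≠ 0 := by simpa using hL
  rw [Pi.mul_apply, ENNReal.inv_rpow, ← ENNReal.rpow_neg]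
  nth_rewrite 1 [← ENNReal.rpow_one (ENNReal.ofReal (likelihood σ C x))]
  rw [← ENNReal.rpow_add _ _ h0 ENNReal.ofReal_ne_top]
  congr 1
  ring

/-- Read backwards, the Hölder bound gives lower bounds for the moments: `A = univ` with `ε = 0`
shows that they are at least `1`, and a superlevel set of `L` shows how fast they grow. -/
theorem mixtureLaw_apply_le_moment {σ C : ℝ} (hσ : 0 < σ) (hC0 : 0 < C) (hC1 : C ≤ 1) {A : Set ℝ}
    (hA : MeasurableSet A) {l ε : ℝ} (hl : 0 < l)
    (h : ENNReal.ofReal (Real.exp ε) * noiseLaw σ A ≤ mixtureLaw σ C A) :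
    (mixtureLaw σ C).real A ≤ Real.exp (-l * ε) * moment σ C (l + 1) := by
  have := isProbabilityMeasure_mixtureLaw hσ hC0 hC1
  have h1 := withDensity_apply_le_moment (noiseLaw σ) (measurable_likelihood σ C).ennreal_ofReal
    hA (measure_ne_top (mixtureLaw σ C) A) hl h
  rw [lintegral_likelihood_rpow hC0 hC1, ← ENNReal.ofReal_mul (Real.exp_pos _).le] at h1
  refine ENNReal.toReal_le_of_le_ofReal (mul_nonneg (Real.exp_pos _).le ?_) h1
  exact integral_nonneg fun x => Real.rpow_nonneg (likelihood_pos hC0 hC1 x).le _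

theorem one_le_moment {σ C : ℝ} (hσ : 0 < σ) (hC0 : 0 < C) (hC1 : C ≤ 1) {l : ℝ} (hl : 0 < l) :
    1 ≤ moment σ C (l + 1) := by
  have := isProbabilityMeasure_mixtureLaw hσ hC0 hC1
  simpa using mixtureLaw_apply_le_moment hσ hC0 hC1 (A := Set.univ) .univ (ε := 0) hl (by simp)

/-- The moments grow faster than every exponential, as the likelihood ratio is unbounded. -/
theorem exists_exp_mul_le_moment {σ C : ℝ} (hσ : 0 < σ) (hC0 : 0 < C) (hC1 : C ≤ 1) (K : ℝ) :
    ∃ p > 0, ∀ l > 0, p * Real.exp (l * K) ≤ moment σ C (l + 1) := by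
  have := isProbabilityMeasure_mixtureLaw hσ hC0 hC1
  have hm := measurable_likelihood σ C
  set A := {x | Real.exp K ≤ likelihood σ C x} with hAdef
  have hA : MeasurableSet A := measurableSet_le measurable_const hm
  have h1 : ENNReal.ofReal (Real.exp K) * noiseLaw σ A ≤ mixtureLaw σ C A := by
    rw [mixtureLaw, withDensity_apply _ hA, ← setLIntegral_const]
    exact setLIntegral_mono hm.ennreal_ofReal fun x hx => ENNReal.ofReal_le_ofReal hx
  have h2 : noiseLaw σ A ≠ 0 := by
    intro h0
    have hv : volume A = 0 :=
      gaussianReal_absolutelyContinuous' 0 (by simp [hσ.ne']) h0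
    -- The solution of `C * exp ((2 * x - 1) / (2 * σ ^ 2)) = exp K`; beyond it the shifted
    -- component alone exceeds `exp K`.
    set x0 := (2 * σ ^ 2 * (K - Real.log C) + 1) / 2
    have hsub : Set.Ici x0 ⊆ A := by
      intro x hx
      have hx' : x0 ≤ x := hx
      have : K - Real.log C ≤ (2 * x - 1) / (2 * σ ^ 2) := by
        rw [le_div_iff₀ (by positivity)]
        simp only [x0] at hx'
        linarith
      have h3 := mul_le_mul_of_nonneg_left (Real.exp_le_exp.2 this) hC0.le
      rw [Real.exp_sub, Real.exp_log hC0, mul_div_cancel₀ _ hC0.ne'] at h3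
      simp only [hAdef, Set.mem_ofPred_eq, likelihood]
      linarith
    have := measure_mono_null hsub hv
    simp at this
  -- The witness is the mixture mass of `A`, positive because the noise mass of `A` is.
  refine ⟨(mixtureLaw σ C).real A, ?_, fun l hl => ?_⟩
  · refine ENNReal.toReal_pos (fun h0 => h2 ?_) (measure_ne_top _ _)
    rw [h0, nonpos_iff_eq_zero, mul_eq_zero] at h1
    exact h1.resolve_left (by simp [Real.exp_pos])
  · have h3 := mixtureLaw_apply_le_moment hσ hC0 hC1 hA hl h1
    calc _ ≤ Real.exp (-l * K) * moment σ C (l + 1) * Real.exp (l * K) := by gcongr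
      _ = moment σ C (l + 1) := by
          rw [mul_right_comm, ← Real.exp_add]; simp

/-! ### The exponent `alpha`, the optimal order and the moment bound for `T` rounds -/

theorem alpha_eq {σ C : ℝ} (hσ : 0 < σ) (hC0 : 0 < C) (hC1 : C ≤ 1) (l : ℝ) :
    alpha l σ C = Real.log (max (moment σ C (-l)) (moment σ C (l + 1))) := by
  rw [alpha, E1_eq hσ hC0 hC1, E2_eq hσ hC0 hC1]

theorem log_moment_le_alpha {σ C : ℝ} (hσ : 0 < σ) (hC0 : 0 < C) (hC1 : C ≤ 1) {l : ℝ}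
    (hl : 0 < l) : Real.log (moment σ C (l + 1)) ≤ alpha l σ C := by
  rw [alpha_eq hσ hC0 hC1]
  have := one_le_moment hσ hC0 hC1 hl
  exact Real.log_le_log (by linarith) (le_max_right _ _)

theorem alpha_nonneg {σ C : ℝ} (hσ : 0 < σ) (hC0 : 0 < C) (hC1 : C ≤ 1) {l : ℝ} (hl : 0 < l) :
    0 ≤ alpha l σ C :=
  (Real.log_nonneg (one_le_moment hσ hC0 hC1 hl)).trans (log_moment_le_alpha hσ hC0 hC1 hl)

theorem exp_alpha {σ C : ℝ} (hσ : 0 < σ) (hC0 : 0 < C) (hC1 : C ≤ 1) {l : ℝ} (hl : 0 < l) :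
    Real.exp (alpha l σ C) = max (moment σ C (-l)) (moment σ C (l + 1)) := by
  rw [alpha_eq hσ hC0 hC1, Real.exp_log]
  exact lt_max_of_lt_right (by linarith [one_le_moment hσ hC0 hC1 hl])

theorem continuousOn_alpha {σ C : ℝ} (hσ : 0 < σ) (hC0 : 0 < C) (hC1 : C ≤ 1) :
    ContinuousOn (fun l => alpha l σ C) (Set.Ioi 0) := by
  have hc := continuous_moment (σ := σ) hC0 hC1
  simp_rw [alpha_eq hσ hC0 hC1]
  refine ContinuousOn.log (Continuous.continuousOn ?_) fun l hl => ?_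
  · exact (hc.comp continuous_neg).max (hc.comp (continuous_id.add continuous_const))
  · exact (lt_max_of_lt_right (by linarith [one_le_moment hσ hC0 hC1 hl])).ne'

/-- The minimum over `l` of the privacy bound is attained. -/
theorem exists_isMin_bound {σ C δ : ℝ} (hσ : 0 < σ) (hC0 : 0 < C) (hC1 : C ≤ 1) {T : ℕ}
    (hT : 0 < T) (hδ0 : 0 < δ) (hδ1 : δ < 1) :
    ∃ l0 > 0, ∀ l > 0, (T * alpha l0 σ C - Real.log δ) / l0 ≤
      (T * alpha l σ C - Real.log δ) / l := by
  set F : ℝ → ℝ := fun l => (T * alpha l σ C - Real.log δ) / l with hF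
  have hD : Real.log δ < 0 := Real.log_neg hδ0 hδ1
  have hT1 : (1 : ℝ) ≤ T := by exact_mod_cast hT
  have hlow : ∀ l > 0, -Real.log δ / l ≤ F l := fun l hl => by
    have := mul_nonneg (by linarith : (0 : ℝ) ≤ T) (alpha_nonneg hσ hC0 hC1 hl)
    simp only [hF]
    gcongr
    linarith
  have hF1 : 0 < F 1 := lt_of_lt_of_le (by linarith) (hlow 1 one_pos)
  -- The rate `F 1 + 1` beats the slope `F 1` by one, so that `F l ≤ F 1` forces `l ≤ -T log p`.
  obtain ⟨p, hp, hgrow⟩ := exists_exp_mul_le_moment hσ hC0 hC1 (F 1 + 1)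
  have ha : ∀ l > 0, F l ≤ F 1 → -Real.log δ / F 1 ≤ l := fun l hl h => by
    have := (hlow l hl).trans h
    rw [div_le_iff₀ hl] at this
    rw [div_le_iff₀ hF1]
    linarith
  have hb : ∀ l > 0, F l ≤ F 1 → l ≤ -(T * Real.log p) := fun l hl h => by
    have h1 : Real.log p + l * (F 1 + 1) ≤ alpha l σ C := by
      refine le_trans ?_ (log_moment_le_alpha hσ hC0 hC1 hl)
      rw [← Real.log_exp (l * (F 1 + 1)), ← Real.log_mul hp.ne' (Real.exp_pos _).ne']
      exact Real.log_le_log (mul_pos hp (Real.exp_pos _)) (hgrow l hl)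
    have h2 := mul_le_mul_of_nonneg_left h1 (by linarith : (0 : ℝ) ≤ T)
    have h3 : T * alpha l σ C - Real.log δ ≤ F 1 * l := (div_le_iff₀ hl).1 h
    have h4 : 1 * (l * (F 1 + 1)) ≤ T * (l * (F 1 + 1)) :=
      mul_le_mul_of_nonneg_right hT1 (by positivity)
    linarith
  -- All points with `F l ≤ F 1` lie in this compact interval away from `0`; the `max` with `1` puts
  -- the comparison point in it as well.
  set s := Set.Icc (-Real.log δ / F 1) (max 1 (-(T * Real.log p)))
  have hpos : 0 < -Real.log δ / F 1 := div_pos (by linarith) hF1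
  have hcont : ContinuousOn F s := by
    have hs : s ⊆ Set.Ioi 0 := fun l hl => lt_of_lt_of_le hpos hl.1
    refine (((continuousOn_const.mul (continuousOn_alpha hσ hC0 hC1)).sub
      continuousOn_const).div continuousOn_id fun l hl => ?_).mono hs
    exact (Set.mem_Ioi.1 hl).ne'
  have h1s : (1 : ℝ) ∈ s := ⟨ha 1 one_pos le_rfl, le_max_left _ _⟩
  obtain ⟨l0, hl0, hmin⟩ := isCompact_Icc.exists_isMinOn ⟨1, h1s⟩ hcont
  refine ⟨l0, lt_of_lt_of_le hpos hl0.1, fun l hl => ?_⟩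
  rcases le_or_gt (F l) (F 1) with h | h
  · exact hmin ⟨ha l hl h, (hb l hl h).trans (le_max_right _ _)⟩
  · exact (hmin h1s).trans h.le

/-- Moment bound for the privacy loss when `T` samples of the mixture are compared with `T` samples
of the noise, in both orders, after attaching independent randomness and postprocessing. -/
theorem measure_lt_privacyLoss_pi_le {Ω O : Type*} [MeasurableSpace Ω] [MeasurableSpace O]
    (R : Measure Ω) [IsProbabilityMeasure R] {σ C : ℝ} (hσ : 0 < σ) (hC0 : 0 < C) (hC1 : C ≤ 1)
    (T : ℕ) {Φ : (Fin T → ℝ × Ω) → O} (hΦ : Measurable Φ) {l : ℝ} (hl : 0 < l) (ε : ℝ)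
    {μ ν : Measure O}
    (hμ : μ = (Measure.pi fun _ : Fin T => (mixtureLaw σ C).prod R).map Φ)
    (hν : ν = (Measure.pi fun _ : Fin T => (noiseLaw σ).prod R).map Φ) :
    μ {o | (ε : EReal) < privacyLoss μ ν o} ≤
        ENNReal.ofReal (Real.exp (T * alpha l σ C - l * ε)) ∧
      ν {o | (ε : EReal) < privacyLoss ν μ o} ≤
        ENNReal.ofReal (Real.exp (T * alpha l σ C - l * ε)) := by
  have hprob := isProbabilityMeasure_mixtureLaw hσ hC0 hC1
  have hm := (measurable_likelihood σ C).ennreal_ofReal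
  -- the bound for a general pair of laws on the real line, one of which has a density
  have key : ∀ (κ : Measure ℝ) (f : ℝ → ℝ≥0∞) (M : ℝ), Measurable f → IsProbabilityMeasure κ →
      IsProbabilityMeasure (κ.withDensity f) → ∫⁻ x, f x ^ (l + 1) ∂κ = ENNReal.ofReal M →
      M ≤ Real.exp (alpha l σ C) → ∀ μ' ν' : Measure O,
      μ' = (Measure.pi fun _ : Fin T => (κ.withDensity f).prod R).map Φ →
      ν' = (Measure.pi fun _ : Fin T => κ.prod R).map Φ →
      μ' {o | (ε : EReal) < privacyLoss μ' ν' o} ≤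
        ENNReal.ofReal (Real.exp (T * alpha l σ C - l * ε)) := by
    intro κ f M hf hκ hκf hM hMα μ' ν' hμ' hν'
    have hf1 : Measurable fun z : ℝ × Ω => f z.1 := hf.comp measurable_fst
    have hprod := prod_withDensity_left (μ := κ) (ν := R) hf
    have hfin : IsProbabilityMeasure ((κ.prod R).withDensity fun z => f z.1) := by
      rw [← hprod]; infer_instance
    have hpi := pi_withDensity (fun _ : Fin T => κ.prod R) (f := fun _ z => f z.1) fun _ => hf1
    have hfin' : IsProbabilityMeasure ((Measure.pi fun _ : Fin T => κ.prod R).withDensity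
        fun x => ∏ i, f (x i).1) := by
      rw [← hpi]; infer_instance
    rw [hprod, hpi] at hμ'
    rw [hμ', hν']
    refine (measure_lt_privacyLoss_map_le _ (by fun_prop) hΦ hl ε).trans ?_
    -- The density involves only the real coordinates, so `R` integrates out and independence turns
    -- the moment into a `T`-th power.
    have hint : ∫⁻ x, (∏ i, f (x i).1) ^ (l + 1) ∂(Measure.pi fun _ : Fin T => κ.prod R) =
        ENNReal.ofReal M ^ T := by
      simp_rw [← ENNReal.prod_rpow_of_nonneg (show 0 ≤ l + 1 by linarith)]
      rw [lintegral_pi_prod_eq_prod (fun _ : Fin T => κ.prod R)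
        (f := fun _ z => f z.1 ^ (l + 1)) fun _ => hf1.pow_const _, Finset.prod_const,
        Finset.card_univ, Fintype.card_fin]
      congr 1
      rw [← hM]
      exact measurePreserving_fst.lintegral_comp (hf.pow_const _)
    rw [hint]
    calc _ ≤ ENNReal.ofReal (Real.exp (-l * ε)) * ENNReal.ofReal (Real.exp (alpha l σ C)) ^ T := by
          gcongr
      _ = _ := by
          rw [← ENNReal.ofReal_pow (Real.exp_pos _).le, ← ENNReal.ofReal_mul (Real.exp_pos _).le,
            ← Real.exp_nat_mul, ← Real.exp_add]
          congr 2
          ring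
  have hexp := exp_alpha hσ hC0 hC1 hl
  constructor
  · exact key (noiseLaw σ) _ _ hm inferInstance hprob (lintegral_likelihood_rpow hC0 hC1 _)
      (hexp ▸ le_max_right _ _) _ _ hμ hν
  -- In the reverse order the mixture is the base measure and the noise has density `1 / L`, which
  -- brings in the moment of order `-l`.
  · have hinv := noiseLaw_eq_withDensity_mixtureLaw (σ := σ) hC0 hC1
    rw [hinv] at hν
    exact key (mixtureLaw σ C) _ _ hm.inv hprob (hinv ▸ inferInstance)
      (lintegral_inv_likelihood_rpow hC0 hC1 _) (hexp ▸ le_max_left _ _) _ _ hν hμ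

/-! ## Laws of functions of independent variables -/

section Product

variable {α β γ O : Type*} [MeasurableSpace α] [MeasurableSpace β] [MeasurableSpace γ]
  [MeasurableSpace O]

/-- Conditioning on the first of two independent variables. -/
theorem map_prod_congr (A : Measure α) (μ : Measure β) (ν : Measure γ) [SFinite μ] [SFinite ν]
    {f : α → β → O} {g : α → γ → O} (hf : Measurable fun p : α × β => f p.1 p.2)
    (hg : Measurable fun p : α × γ => g p.1 p.2) (h : ∀ a, μ.map (f a) = ν.map (g a)) :
    (A.prod μ).map (fun p => f p.1 p.2) = (A.prod ν).map (fun p => g p.1 p.2) := by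
  ext s hs
  rw [Measure.map_apply hf hs, Measure.map_apply hg hs, Measure.prod_apply (hf hs),
    Measure.prod_apply (hg hs)]
  refine lintegral_congr fun a => ?_
  have := congrArg (· s) (h a)
  have hfa : Measurable (f a) := hf.comp measurable_prodMk_left
  have hga : Measurable (g a) := hg.comp measurable_prodMk_left
  rwa [Measure.map_apply hfa hs, Measure.map_apply hga hs] at this

theorem map_prod_left_comm (A : Measure α) (B : Measure β) (μ : Measure γ) [SFinite A] [SFinite B]
    [SFinite μ] {F : α × β × γ → O} (hF : Measurable F) :
    (A.prod (B.prod μ)).map F = (B.prod (A.prod μ)).map fun p => F (p.2.1, p.1, p.2.2) := by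
  have h1 : MeasurePreserving (fun p : (α × β) × γ => (p.1.1, p.1.2, p.2))
    ((A.prod B).prod μ) (A.prod (B.prod μ)) := measurePreserving_prodAssoc A B μ
  have h2 : MeasurePreserving (fun p : (β × α) × γ => (p.1.1, p.1.2, p.2))
    ((B.prod A).prod μ) (B.prod (A.prod μ)) := measurePreserving_prodAssoc B A μ
  have h3 : MeasurePreserving (Prod.map Prod.swap id : (β × α) × γ → (α × β) × γ)
    ((B.prod A).prod μ) ((A.prod B).prod μ) :=
    Measure.measurePreserving_swap.prod (MeasurePreserving.id μ)
  rw [← (h1.comp h3).map_eq, ← h2.map_eq, Measure.map_map hF (h1.comp h3).measurable,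
    Measure.map_map (by fun_prop) h2.measurable]
  rfl

theorem map_map_prod_prod {δ : Type*} [MeasurableSpace δ] (A : Measure α) (B : Measure β)
    (μ : Measure γ) [SFinite A] [SFinite B] [SFinite μ] {h : α × β → δ} (hh : Measurable h)
    {F : δ × γ → O} (hF : Measurable F) :
    (((A.prod B).map h).prod μ).map F =
      (A.prod (B.prod μ)).map fun p => F (h (p.1, p.2.1), p.2.2) := by
  have h1 : MeasurePreserving (fun p : (α × β) × γ => (p.1.1, p.1.2, p.2))
    ((A.prod B).prod μ) (A.prod (B.prod μ)) := measurePreserving_prodAssoc A B μ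
  have h2 := Measure.map_prod_map (A.prod B) μ hh measurable_id
  rw [Measure.map_id] at h2
  rw [h2, Measure.map_map hF (hh.prodMap measurable_id), ← h1.map_eq,
    Measure.map_map (by fun_prop) h1.measurable]
  rfl

theorem pi_prod_eq_map {ι : Type*} [Fintype ι] (μ : Measure α) (ν : Measure β) [SigmaFinite μ]
    [SigmaFinite ν] : Measure.pi (fun _ : ι => μ.prod ν) =
      ((Measure.pi fun _ : ι => μ).prod (Measure.pi fun _ : ι => ν)).map
        fun p k => (p.1 k, p.2 k) :=
  (measurePreserving_arrowProdEquivProdArrow α β ι (fun _ => μ) fun _ => ν).symm.map_eq.symm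

/-- Resampling one of several independent variables. -/
theorem map_update_pi_prod {ι : Type*} [Fintype ι] [DecidableEq ι] (μ : Measure α)
    [IsProbabilityMeasure μ] (j : ι) :
    ((Measure.pi fun _ : ι => μ).prod μ).map (fun p => Function.update p.1 j p.2) =
      Measure.pi fun _ : ι => μ := by
  have hm : Measurable fun p : (ι → α) × α => Function.update p.1 j p.2 :=
    measurable_update'
  refine (Measure.pi_eq fun s hs => ?_).symm
  rw [Measure.map_apply hm (MeasurableSet.univ_pi hs)]
  -- The old coordinate `j` becomes unconstrained and the fresh variable takes over its constraint.
  have e : (fun p : (ι → α) × α => Function.update p.1 j p.2) ⁻¹' Set.univ.pi s =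
      (Set.univ.pi (Function.update s j Set.univ)) ×ˢ s j := by
    ext p
    simp only [Set.mem_preimage, Set.mem_pi, Set.mem_univ, true_implies, Set.mem_prod]
    constructor
    · refine fun h => ⟨fun k => ?_, by simpa using h j⟩
      by_cases hk : k = j
      · subst hk; simp
      · simpa [hk] using h k
    · rintro ⟨h1, h2⟩ k
      by_cases hk : k = j
      · subst hk; simpa using h2
      · simpa [hk] using h1 k
  rw [e, Measure.prod_prod, Measure.pi_pi, ← Finset.mul_prod_erase _ _ (Finset.mem_univ j),
    ← Finset.mul_prod_erase Finset.univ (fun i => μ (s i)) (Finset.mem_univ j),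
    Function.update_self, measure_univ, one_mul, mul_comm]
  congr 1
  refine Finset.prod_congr rfl fun i hi => ?_
  rw [Function.update_of_ne (Finset.ne_of_mem_erase hi)]

end Product

/-! ## Gaussian noise -/

section Gaussian

variable {m : ℕ}

theorem charFun_map_smul_stdGaussian (τ : ℝ) (t : Vec m) :
    charFun ((stdGaussian (Vec m)).map fun g => τ • g) t =
      Complex.exp (-(τ ^ 2 * ‖t‖ ^ 2 : ℝ) / 2) := by
  rw [charFun_map_smul, charFun_stdGaussian, norm_smul, ← Complex.ofReal_pow, mul_pow,
    Real.norm_eq_abs, sq_abs]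

/-- Independent noise shares of standard deviation `τ / √|K|` sum to noise of standard
deviation `τ`. -/
theorem map_sum_noise_shares {ι : Type*} [Fintype ι] [DecidableEq ι] (K : Finset ι) (τ : ℝ) :
    ((Measure.pi fun _ : ι => stdGaussian (Vec m)).prod (stdGaussian (Vec m))).map
      (fun p => if K = ∅ then τ • p.2 else ∑ k ∈ K, (τ / Real.sqrt (K.card : ℝ)) • p.1 k) =
    (stdGaussian (Vec m)).map fun g => τ • g := by
  by_cases hK : K = ∅
  · simp only [hK, if_true]
    have := Measure.map_map (μ := (Measure.pi fun _ : ι => stdGaussian (Vec m)).prod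
      (stdGaussian (Vec m))) (g := fun g : Vec m => τ • g) (f := Prod.snd) (by fun_prop) (by fun_prop)
    rw [measurePreserving_snd.map_eq] at this
    exact this.symm
  · simp only [hK, if_false]
    have hcard : (0 : ℝ) < K.card := by
      exact_mod_cast Finset.card_pos.2 (Finset.nonempty_iff_ne_empty.2 hK)
    -- Zero coefficients outside `K` make the sum run over all indices, so characteristic functions
    -- multiply; the squares add up to `|K| * (τ ^ 2 / |K|) = τ ^ 2`.
    set c : ι → ℝ := fun k => if k ∈ K then τ / Real.sqrt (K.card : ℝ) else 0
    set μ : ι → Measure (Vec m) := fun k => (stdGaussian (Vec m)).map fun g => c k • g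
    have hμ : ∀ k, IsProbabilityMeasure (μ k) := fun k =>
      Measure.isProbabilityMeasure_map (by fun_prop)
    have e1 : ((Measure.pi fun _ : ι => stdGaussian (Vec m)).prod (stdGaussian (Vec m))).map
        (fun p => ∑ k ∈ K, (τ / Real.sqrt (K.card : ℝ)) • p.1 k) =
        (Measure.pi μ).map fun p => ∑ k, p k := by
      have h2 : Measure.pi μ = (Measure.pi fun _ : ι => stdGaussian (Vec m)).map
          fun p k => c k • p k :=
        (Measure.pi_map_pi (f := fun k (g : Vec m) => c k • g) (fun k => by fun_prop)).symm
      have h3 : Measure.pi (fun _ : ι => stdGaussian (Vec m)) =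
          ((Measure.pi fun _ : ι => stdGaussian (Vec m)).prod (stdGaussian (Vec m))).map
            Prod.fst := measurePreserving_fst.map_eq.symm
      rw [h2, Measure.map_map (by fun_prop) (by fun_prop), h3,
        Measure.map_map (by fun_prop) (by fun_prop), ← h3]
      congr 1
      ext1 p
      simp [c, ite_smul, Finset.sum_ite_mem]
    rw [e1]
    have := Measure.isProbabilityMeasure_map (μ := Measure.pi μ) (f := fun p => ∑ k, p k)
      (by fun_prop)
    have := Measure.isProbabilityMeasure_map (μ := stdGaussian (Vec m)) (f := fun g => τ • g)
      (by fun_prop)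
    refine Measure.ext_of_charFun ?_
    rw [charFun_map_sum_pi_eq_prod]
    ext t
    rw [Finset.prod_apply]
    simp only [μ, charFun_map_smul_stdGaussian]
    rw [← Complex.exp_sum]
    congr 1
    rw [← Finset.sum_div]
    congr 1
    rw [← Complex.ofReal_neg, Finset.sum_congr rfl fun k _ => (Complex.ofReal_neg _).symm,
      ← Complex.ofReal_sum]
    congr 1
    rw [Finset.sum_neg_distrib, ← Finset.sum_mul]
    have : ∑ k, c k ^ 2 = τ ^ 2 := by
      simp only [c, ite_pow, Finset.sum_ite_mem, Finset.univ_inter, ne_eq, OfNat.ofNat_ne_zero,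
        not_false_eq_true, zero_pow, Finset.sum_const, nsmul_eq_mul, div_pow,
        Real.sq_sqrt hcard.le]
      field_simp
    rw [this]

/-- The part of a standard Gaussian vector `g` that complements a one-dimensional standard Gaussian
in direction `v`: its covariance is `1 - v vᵀ`. -/
def complementNoise (v g : Vec m) : Vec m :=
  g - ((1 + Real.sqrt (1 - ‖v‖ ^ 2))⁻¹ * inner ℝ v g) • v

/-- Self-adjointness moves the operator from the random vector to the argument of the characteristic
function. -/
theorem inner_complementNoise (v g t : Vec m) :
    inner ℝ (complementNoise v g) t = inner ℝ g (complementNoise v t) := by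
  simp only [complementNoise, inner_sub_left, inner_sub_right, real_inner_smul_left,
    real_inner_smul_right, real_inner_comm g v]
  ring

/-- The operator is the symmetric square root of `1 - v vᵀ`. With `r = √(1 - ‖v‖²)`, its coefficient
`c = 1 / (1 + r)` solves `2 c - c² ‖v‖² = 1`, because `‖v‖² = (1 - r) (1 + r)`. Nothing is divided
by `‖v‖`, so `v = 0` is allowed. -/
theorem norm_complementNoise_sq {v : Vec m} (hv : ‖v‖ ≤ 1) (t : Vec m) :
    ‖complementNoise v t‖ ^ 2 = ‖t‖ ^ 2 - inner ℝ v t ^ 2 := by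
  have h0 : 0 ≤ 1 - ‖v‖ ^ 2 := by nlinarith [norm_nonneg v]
  have hs := Real.sq_sqrt h0
  have hpos : 0 < 1 + Real.sqrt (1 - ‖v‖ ^ 2) := by positivity
  rw [complementNoise, norm_sub_sq_real, real_inner_smul_right, norm_smul, mul_pow,
    Real.norm_eq_abs, sq_abs, real_inner_comm]
  set r := Real.sqrt (1 - ‖v‖ ^ 2)
  have : ‖v‖ ^ 2 = 1 - r ^ 2 := by linarith
  rw [this]
  field_simp
  ring

theorem measurable_complementNoise :
    Measurable fun p : Vec m × Vec m => complementNoise p.1 p.2 := by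
  unfold complementNoise
  fun_prop

/-- The covariances `σ² v vᵀ` and `σ² (1 - v vᵀ)` of the independent parts add up to `σ²` times the
identity. This is where `‖v‖ ≤ 1`, hence clipping, is needed. -/
theorem map_add_complementNoise {v : Vec m} (hv : ‖v‖ ≤ 1) (σ : ℝ) :
    ((noiseLaw σ).prod (stdGaussian (Vec m))).map
      (fun p => p.1 • v + σ • complementNoise v p.2) =
    (stdGaussian (Vec m)).map fun g => σ • g := by
  have hm : Measurable (complementNoise v) :=
    measurable_complementNoise.comp measurable_prodMk_left
  have hm1 : Measurable fun p : ℝ × Vec m => p.1 • v + σ • complementNoise v p.2 := by fun_prop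
  have := Measure.isProbabilityMeasure_map (μ := (noiseLaw σ).prod (stdGaussian (Vec m)))
    hm1.aemeasurable
  have := Measure.isProbabilityMeasure_map (μ := stdGaussian (Vec m)) (f := fun g => σ • g)
    (by fun_prop)
  refine Measure.ext_of_charFun (funext fun t => ?_)
  rw [charFun_map_smul_stdGaussian, charFun_apply, integral_map hm1.aemeasurable
    (by fun_prop)]
  have e : ∀ p : ℝ × Vec m,
      Complex.exp ((inner ℝ (p.1 • v + σ • complementNoise v p.2) t : ℝ) * Complex.I) =
      Complex.exp ((inner ℝ v t : ℝ) * p.1 * Complex.I) *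
        Complex.exp ((inner ℝ p.2 (σ • complementNoise v t) : ℝ) * Complex.I) := by
    intro p
    rw [← Complex.exp_add, inner_add_left, real_inner_smul_left, real_inner_smul_left,
      inner_complementNoise, real_inner_smul_right]
    push_cast
    congr 1
    ring
  simp_rw [e]
  rw [integral_prod_mul (fun x : ℝ => Complex.exp ((inner ℝ v t : ℝ) * x * Complex.I))
    (fun g : Vec m => Complex.exp ((inner ℝ g (σ • complementNoise v t) : ℝ) * Complex.I)),
    ← charFun_apply_real, ← charFun_apply, charFun_stdGaussian, noiseLaw, charFun_gaussianReal,
    ← Complex.exp_add, norm_smul, ← Complex.ofReal_pow (‖σ‖ * _), mul_pow, Real.norm_eq_abs,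
    sq_abs, Real.coe_toNNReal _ (sq_nonneg σ)]
  congr 1
  have h := norm_complementNoise_sq hv t
  have h' : ((‖complementNoise v t‖ : ℂ)) ^ 2 = (‖t‖ : ℂ) ^ 2 - (inner ℝ v t : ℝ) ^ 2 := by
    exact_mod_cast congrArg (fun x : ℝ => (x : ℂ)) h
  push_cast
  rw [h']
  ring

end Gaussian

section Protocol

variable {N n m : ℕ} {X Seed : Type*}

/-! ## The protocol with an arbitrary randomized aggregate -/

section RunWith

variable {Ω Ω' : Type*} [MeasurableSpace Ω] [MeasurableSpace Ω']

/-- One round of the server on the aggregate `y`, recorded in the transcript. -/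
def roundStep (P : Params N n m X Seed) {T : ℕ} (prev : ServerState n m × Transcript T n m)
    (y : Vec m) : ServerState n m × Transcript (T + 1) n m :=
  (serverStep P prev.1 y, Fin.snoc prev.2 (y, (serverStep P prev.1 y).1))

/-- `T` rounds of the protocol, where `agg w ω` is the aggregate of a round with current model `w`
and randomness `ω`. -/
def runWith (P : Params N n m X Seed) (agg : Vec n → Ω → Vec m) :
    (T : ℕ) → (Fin T → Ω) → ServerState n m × Transcript T n m
  | 0, _ => ((P.w0, 0, 0), Fin.elim0)
  | T + 1, r => roundStep P (runWith P agg T (Fin.init r))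
      (agg (runWith P agg T (Fin.init r)).1.1 (r (Fin.last T)))

theorem run_eq_runWith (P : Params N n m X Seed) (D : Federation N X) (T : ℕ) :
    run P D T = runWith P (aggregate P D) T := by
  induction T with
  | zero => rfl
  | succ T ih =>
    ext1 r
    simp only [run, runWith, ih, roundStep]

theorem measurable_roundStep (P : Params N n m X Seed) (hdec : Measurable P.decompress) (T : ℕ) :
    Measurable fun p : (ServerState n m × Transcript T n m) × Vec m => roundStep P p.1 p.2 := by
  have h : Measurable fun p : (ServerState n m × Transcript T n m) × Vec m =>
      serverStep P p.1.1 p.2 :=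
    (measurable_serverStep P hdec).comp (measurable_fst.fst.prodMk measurable_snd)
  refine h.prodMk (measurable_pi_lambda _ fun i => ?_)
  refine Fin.lastCases ?_ (fun i => ?_) i
  · simp only [Fin.snoc_last]
    exact measurable_snd.prodMk h.fst
  · simp only [Fin.snoc_castSucc]
    exact (measurable_pi_apply i).comp measurable_fst.snd

theorem measurable_runWith (P : Params N n m X Seed) (hdec : Measurable P.decompress)
    {agg : Vec n → Ω → Vec m} (hagg : Measurable fun p : Vec n × Ω => agg p.1 p.2) (T : ℕ) :
    Measurable (runWith P agg T) := by
  induction T with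
  | zero => exact measurable_const
  | succ T ih =>
    have h1 : Measurable fun r : Fin (T + 1) → Ω => runWith P agg T (Fin.init r) :=
      ih.comp (measurable_pi_lambda _ fun i => measurable_pi_apply _)
    exact (measurable_roundStep P hdec T).comp
      (h1.prodMk (hagg.comp (h1.fst.fst.prodMk (measurable_pi_apply (Fin.last T)))))

/-- The run is a Markov chain: the randomness of the last round is independent of the state and
transcript so far, which permits induction on `T`. -/
theorem map_runWith_succ (P : Params N n m X Seed) (hdec : Measurable P.decompress)
    (R : Measure Ω) [IsProbabilityMeasure R]
    {agg : Vec n → Ω → Vec m} (hagg : Measurable fun p : Vec n × Ω => agg p.1 p.2) (T : ℕ) :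
    (Measure.pi fun _ : Fin (T + 1) => R).map (runWith P agg (T + 1)) =
      (((Measure.pi fun _ : Fin T => R).map (runWith P agg T)).prod R).map
        fun p => roundStep P p.1 (agg p.1.1.1 p.2) := by
  have hrun := measurable_runWith P hdec hagg T
  have hstep : Measurable fun p : (ServerState n m × Transcript T n m) × Ω =>
      roundStep P p.1 (agg p.1.1.1 p.2) :=
    (measurable_roundStep P hdec T).comp
      (measurable_fst.prodMk (hagg.comp (measurable_fst.fst.fst.prodMk measurable_snd)))
  have h1 := measurePreserving_piFinSuccAbove (fun _ : Fin (T + 1) => R) (Fin.last T)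
  have h2 := Measure.map_prod_map (Measure.pi fun _ : Fin T => R) R hrun measurable_id
  rw [Measure.map_id] at h2
  rw [h2, Measure.map_map hstep (hrun.prodMap measurable_id), ← Measure.prod_swap,
    Measure.map_map (hstep.comp (hrun.prodMap measurable_id)) measurable_swap, ← h1.map_eq,
    Measure.map_map ((hstep.comp (hrun.prodMap measurable_id)).comp measurable_swap) h1.measurable]
  congr 1
  ext1 r
  have : (MeasurableEquiv.piFinSuccAbove (fun _ : Fin (T + 1) => Ω) (Fin.last T) r) =
      (r (Fin.last T), Fin.init r) := by
    refine Prod.ext rfl ?_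
    ext i
    simp [MeasurableEquiv.piFinSuccAbove, Fin.init]
  simp only [Function.comp_apply, this, Prod.swap, Prod.map, id]
  rfl

/-- The law of a run depends only on the conditional laws of the aggregates. -/
theorem map_runWith_congr (P : Params N n m X Seed) (hdec : Measurable P.decompress)
    (R : Measure Ω) [IsProbabilityMeasure R] (Q : Measure Ω') [IsProbabilityMeasure Q]
    {a : Vec n → Ω → Vec m} (ha : Measurable fun p : Vec n × Ω => a p.1 p.2)
    {b : Vec n → Ω' → Vec m} (hb : Measurable fun p : Vec n × Ω' => b p.1 p.2)
    (h : ∀ w, R.map (a w) = Q.map (b w)) (T : ℕ) :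
    (Measure.pi fun _ : Fin T => R).map (runWith P a T) =
      (Measure.pi fun _ : Fin T => Q).map (runWith P b T) := by
  induction T with
  | zero =>
    have e1 : runWith P a 0 = fun _ => ((P.w0, 0, 0), Fin.elim0) := rfl
    have e2 : runWith P b 0 = fun _ => ((P.w0, 0, 0), Fin.elim0) := rfl
    simp [e1, e2, Measure.map_const]
  | succ T ih =>
    have hs := measurable_roundStep P hdec T
    rw [map_runWith_succ P hdec R ha, map_runWith_succ P hdec Q hb, ih]
    -- Given the past `s`, the new aggregate enters only through its law at the current model
    -- `s.1.1`, where the hypothesis applies.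
    refine map_prod_congr _ R Q (f := fun s ω => roundStep P s (a s.1.1 ω))
      (g := fun s ω => roundStep P s (b s.1.1 ω))
      (hs.comp (measurable_fst.prodMk (ha.comp (measurable_fst.fst.fst.prodMk measurable_snd))))
      (hs.comp (measurable_fst.prodMk (hb.comp (measurable_fst.fst.fst.prodMk measurable_snd))))
      fun s => ?_
    have hs' : Measurable (roundStep P s) := hs.comp measurable_prodMk_left
    have ha' : Measurable (a s.1.1) := ha.comp measurable_prodMk_left
    have hb' : Measurable (b s.1.1) := hb.comp measurable_prodMk_left
    have := congrArg (Measure.map (roundStep P s)) (h s.1.1)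
    rwa [Measure.map_map hs' ha', Measure.map_map hs' hb'] at this

end RunWith

/-! ## The law of the aggregate of one round -/

theorem norm_clip_le {S : ℝ} (hS : 0 < S) (c : Vec m) : ‖clip S c‖ ≤ S := by
  have h1 : 0 < max 1 (‖c‖ / S) := lt_max_of_lt_left one_pos
  rw [clip, norm_smul, norm_inv, Real.norm_of_nonneg h1.le, inv_mul_le_iff₀ h1]
  calc ‖c‖ = ‖c‖ / S * S := (div_mul_cancel₀ _ hS.ne').symm
    _ ≤ _ := by gcongr; exact le_max_right _ _

/-- The sum of the clipped updates of the present clients `k` with `b k = true`. -/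
def updateSum (P : Params N n m X Seed) (D : Federation N X) (w : Vec n) (s : Fin N → Seed)
    (b : Fin N → Bool) : Vec m :=
  ∑ k ∈ Finset.univ.filter fun k => (D k).isSome = true ∧ b k = true,
    (D k).elim 0 fun x => clippedUpdate P x w (s k)

/-- The law of a selection bit. -/
def selectionLaw (C : ℝ) : Measure Bool :=
  ENNReal.ofReal C • Measure.dirac true + ENNReal.ofReal (1 - C) • Measure.dirac false

theorem isProbabilityMeasure_selectionLaw {C : ℝ} (hC0 : 0 ≤ C) (hC1 : C ≤ 1) :
    IsProbabilityMeasure (selectionLaw C) := by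
  constructor
  simp only [selectionLaw, Measure.add_apply, Measure.smul_apply, measure_univ, smul_eq_mul,
    mul_one]
  rw [← ENNReal.ofReal_add hC0 (by linarith)]
  simp

/-- A sample of the mixture is noise, shifted by `1` with probability `C`. -/
theorem mixtureLaw_eq_map {σ C : ℝ} (hσ : 0 < σ) (hC0 : 0 < C) (hC1 : C ≤ 1) :
    mixtureLaw σ C = ((selectionLaw C).prod (noiseLaw σ)).map
      fun p => (if p.1 = true then 1 else 0) + p.2 := by
  have hm : Measurable fun p : Bool × ℝ => (if p.1 = true then (1 : ℝ) else 0) + p.2 :=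
    measurable_from_prod_countable_right fun b => by cases b <;> simp <;> fun_prop
  rw [mixtureLaw_eq hσ hC0 hC1, selectionLaw, Measure.add_prod, Measure.prod_smul_left,
    Measure.prod_smul_left, Measure.dirac_prod, Measure.dirac_prod, Measure.map_add _ _ hm,
    Measure.map_smul, Measure.map_smul, Measure.map_map hm measurable_prodMk_left,
    Measure.map_map hm measurable_prodMk_left, add_comm]
  simp [Function.comp_def]

/-- The absent client's bit does not matter to `D'`, so a fresh bit `β` for client `j` decides alone
whether its update is added. -/
theorem updateSum_update {P : Params N n m X Seed} {D D' : Federation N X} {j : Fin N} {x : X}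
    (hj : D j = some x) (hj' : D' j = none) (hne : ∀ k, k ≠ j → D k = D' k) (w : Vec n)
    (s : Fin N → Seed) (b : Fin N → Bool) (β : Bool) :
    updateSum P D w s (Function.update b j β) =
      updateSum P D' w s b + if β = true then clippedUpdate P x w (s j) else 0 := by
  simp only [updateSum, Finset.sum_filter]
  rw [← Finset.add_sum_erase _ _ (Finset.mem_univ j),
    ← Finset.add_sum_erase Finset.univ _ (Finset.mem_univ j)]
  simp only [hj, hj', Function.update_self, Option.isSome_some, Option.isSome_none, true_and,
    Option.elim_some, Bool.false_eq_true, false_and, if_false, zero_add]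
  rw [add_comm]
  congr 1
  refine Finset.sum_congr rfl fun k hk => ?_
  have hk' := Finset.ne_of_mem_erase hk
  rw [hne k hk', Function.update_of_ne hk']

variable [MeasurableSpace Seed]

theorem measurable_updateSum (P : Params N n m X Seed) (D : Federation N X)
    (hsgd : ∀ x, Measurable fun p : Vec n × Seed => P.sgd x p.1 p.2) :
    Measurable fun p : (Fin N → Bool) × Vec n × (Fin N → Seed) =>
      updateSum P D p.2.1 p.2.2 p.1 := by
  refine measurable_from_prod_countable_right fun b => ?_
  simp only [updateSum]
  refine Finset.measurable_fun_sum _ fun k _ => ?_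
  cases D k with
  | none => exact measurable_const
  | some x =>
    exact (measurable_clippedUpdate P x (hsgd x)).comp
      (g := fun p : Vec n × Seed => clippedUpdate P x p.1 p.2)
      (f := fun p : Vec n × (Fin N → Seed) => (p.1, p.2 k)) (by fun_prop)

/-- The randomness of a round, sorted into seeds, selection bits and noise. -/
theorem map_roundLaw {O : Type*} [MeasurableSpace O] {C : ℝ} (hC0 : 0 ≤ C) (hC1 : C ≤ 1)
    (seedLaw : Measure Seed) [IsProbabilityMeasure seedLaw] {F : RoundRand N m Seed → O}
    (hF : Measurable F) :
    (roundLaw N m C seedLaw).map F =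
      ((Measure.pi fun _ : Fin N => seedLaw).prod
        ((Measure.pi fun _ : Fin N => selectionLaw C).prod
          ((Measure.pi fun _ : Fin N => stdGaussian (Vec m)).prod (stdGaussian (Vec m))))).map
        fun p => F (fun k => (p.2.1 k, p.1 k, p.2.2.1 k), p.2.2.2) := by
  have := isProbabilityMeasure_selectionLaw hC0 hC1
  have hm1 : Measurable fun p : (Fin N → Bool) × (Fin N → Seed × Vec m) =>
      fun k => (p.1 k, p.2 k) := by fun_prop
  have hm2 : Measurable fun p : (Fin N → Seed) × (Fin N → Vec m) =>
      fun k => (p.1 k, p.2 k) := by fun_prop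
  have e1 : roundLaw N m C seedLaw = (Measure.pi fun _ : Fin N =>
      (selectionLaw C).prod (seedLaw.prod (stdGaussian (Vec m)))).prod (stdGaussian (Vec m)) := rfl
  rw [e1, pi_prod_eq_map, map_map_prod_prod _ _ _ hm1 hF, pi_prod_eq_map]
  have hF1 : Measurable fun p : (Fin N → Bool) × (Fin N → Seed × Vec m) × Vec m =>
      F (fun k => (p.1 k, p.2.1 k), p.2.2) := hF.comp (by fun_prop)
  have hF2 : Measurable fun p : (Fin N → Seed × Vec m) × (Fin N → Bool) × Vec m =>
      F (fun k => (p.2.1 k, p.1 k), p.2.2) := hF.comp (by fun_prop)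
  have hF3 : Measurable fun p : (Fin N → Seed) × (Fin N → Vec m) × (Fin N → Bool) × Vec m =>
      F (fun k => (p.2.2.1 k, p.1 k, p.2.1 k), p.2.2.2) := hF.comp (by fun_prop)
  have hF4 : Measurable fun p : (Fin N → Seed) × (Fin N → Bool) × (Fin N → Vec m) × Vec m =>
      F (fun k => (p.2.1 k, p.1 k, p.2.2.1 k), p.2.2.2) := hF.comp (by fun_prop)
  rw [map_prod_left_comm _ _ _ hF1, map_map_prod_prod _ _ _ hm2 hF2]
  exact map_prod_congr _ _ _
    (f := fun (s : Fin N → Seed) (q : (Fin N → Vec m) × (Fin N → Bool) × Vec m) =>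
      F (fun k => (q.2.1 k, s k, q.1 k), q.2.2))
    (g := fun (s : Fin N → Seed) (q : (Fin N → Bool) × (Fin N → Vec m) × Vec m) =>
      F (fun k => (q.1 k, s k, q.2.1 k), q.2.2)) hF3 hF4 fun s =>
      map_prod_left_comm _ _ _ (hF3.comp measurable_prodMk_left)

end Protocol

/-! ### Reduction of a round to one real sample, and privacy of the protocol -/

section Aggregate

variable {N n m : ℕ} {X Seed : Type*}

/-- Separates updates from noise; if nobody is selected the update sum is empty, so both branches
fit one formula. -/
theorem aggregate_eq (P : Params N n m X Seed) (D : Federation N X) (w : Vec n)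
    (s : Fin N → Seed) (b : Fin N → Bool) (g : (Fin N → Vec m) × Vec m) :
    aggregate P D w (fun k => (b k, s k, g.1 k), g.2) = updateSum P D w s b +
      if (Finset.univ.filter fun k => (D k).isSome = true ∧ b k = true) = ∅
        then (P.S * P.σ) • g.2
      else ∑ k ∈ Finset.univ.filter fun k => (D k).isSome = true ∧ b k = true,
        (P.S * P.σ / Real.sqrt (((Finset.univ.filter fun k =>
          (D k).isSome = true ∧ b k = true).card : ℕ) : ℝ)) • g.1 k := by
  simp only [aggregate, selected, updateSum]
  split_ifs with h
  · rw [h, Finset.sum_empty, zero_add]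
  · rw [Finset.sum_add_distrib]

/-- The direction of the contribution of client `j` with dataset `x`. -/
def direction (P : Params N n m X Seed) (x : X) (w : Vec n) (s : Seed) : Vec m :=
  P.S⁻¹ • clippedUpdate P x w s

theorem norm_direction_le {P : Params N n m X Seed} (hS : 0 < P.S) (x : X) (w : Vec n) (s : Seed) :
    ‖direction P x w s‖ ≤ 1 := by
  rw [direction, norm_smul, norm_inv, Real.norm_of_nonneg hS.le, inv_mul_le_iff₀ hS, mul_one]
  exact norm_clip_le hS _

variable [MeasurableSpace Seed]

/-- The law of the seeds, selection bits and aggregated noise of a round. -/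
def sortedLaw (N m : ℕ) (C : ℝ) (seedLaw : Measure Seed) :
    Measure ((Fin N → Seed) × (Fin N → Bool) × Vec m) :=
  (Measure.pi fun _ : Fin N => seedLaw).prod
    ((Measure.pi fun _ : Fin N => selectionLaw C).prod (stdGaussian (Vec m)))

theorem measurable_updateSum_add_noise (P : Params N n m X Seed) (D : Federation N X)
    (hsgd : ∀ x, Measurable fun p : Vec n × Seed => P.sgd x p.1 p.2) (w : Vec n) :
    Measurable fun p : (Fin N → Seed) × (Fin N → Bool) × Vec m =>
      updateSum P D w p.1 p.2.1 + (P.S * P.σ) • p.2.2 := by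
  have h : Measurable fun p : (Fin N → Seed) × (Fin N → Bool) × Vec m =>
      updateSum P D w p.1 p.2.1 :=
    (measurable_updateSum P D hsgd).comp
      (f := fun p : (Fin N → Seed) × (Fin N → Bool) × Vec m => (p.2.1, w, p.1)) (by fun_prop)
  fun_prop

/-- The aggregate of a round is the sum of the updates of the selected clients and Gaussian noise
of standard deviation `S σ`. -/
theorem map_aggregate (P : Params N n m X Seed) (D : Federation N X)
    (hsgd : ∀ x, Measurable fun p : Vec n × Seed => P.sgd x p.1 p.2)
    (hC0 : 0 ≤ P.C) (hC1 : P.C ≤ 1) (seedLaw : Measure Seed) [IsProbabilityMeasure seedLaw]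
    (w : Vec n) :
    (roundLaw N m P.C seedLaw).map (aggregate P D w) = (sortedLaw N m P.C seedLaw).map
      fun p => updateSum P D w p.1 p.2.1 + (P.S * P.σ) • p.2.2 := by
  have := isProbabilityMeasure_selectionLaw hC0 hC1
  have hF : Measurable (aggregate P D w) :=
    (measurable_aggregate P D hsgd).comp (f := fun q => (w, q)) (by fun_prop)
  have h1 : Measurable fun p : (Fin N → Seed) × (Fin N → Bool) × (Fin N → Vec m) × Vec m =>
      aggregate P D w (fun k => (p.2.1 k, p.1 k, p.2.2.1 k), p.2.2.2) :=
    hF.comp (f := fun p : (Fin N → Seed) × (Fin N → Bool) × (Fin N → Vec m) × Vec m =>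
      (fun k => (p.2.1 k, p.1 k, p.2.2.1 k), p.2.2.2)) (by fun_prop)
  have h2 : Measurable fun p : (Fin N → Seed) × (Fin N → Bool) × Vec m =>
      updateSum P D w p.1 p.2.1 + (P.S * P.σ) • p.2.2 :=
    measurable_updateSum_add_noise P D hsgd w
  rw [map_roundLaw hC0 hC1 seedLaw hF, sortedLaw]
  refine map_prod_congr _ _ _
    (f := fun s (q : (Fin N → Bool) × (Fin N → Vec m) × Vec m) =>
      aggregate P D w (fun k => (q.1 k, s k, q.2.1 k), q.2.2))
    (g := fun s (q : (Fin N → Bool) × Vec m) => updateSum P D w s q.1 + (P.S * P.σ) • q.2)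
    h1 h2 fun s => ?_
  refine map_prod_congr _ _ _
    (f := fun b (q : (Fin N → Vec m) × Vec m) =>
      aggregate P D w (fun k => (b k, s k, q.1 k), q.2))
    (g := fun b (g : Vec m) => updateSum P D w s b + (P.S * P.σ) • g)
    (h1.comp (f := fun q => (s, q)) (by fun_prop)) (h2.comp (f := fun q => (s, q)) (by fun_prop)) fun b => ?_
  simp_rw [aggregate_eq]
  -- With seeds and bits fixed, the selected set is deterministic, so the shares, whose scale
  -- depends on it, sum to noise whose law does not.
  have hsum := congrArg (Measure.map (updateSum P D w s b + ·)) (map_sum_noise_shares (m := m)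
    (Finset.univ.filter fun k => (D k).isSome = true ∧ b k = true) (P.S * P.σ))
  rwa [Measure.map_map (by fun_prop) (by split_ifs <;> fun_prop),
    Measure.map_map (by fun_prop) (by fun_prop)] at hsum

/-- The aggregate of a round obtained from a real number `q.1`: noise without client `j`, a sample
of the mixture with client `j`. -/
def simulate (P : Params N n m X Seed) (D : Federation N X) (x : X) (j : Fin N) (w : Vec n)
    (q : ℝ × (Fin N → Seed) × (Fin N → Bool) × Vec m) : Vec m :=
  updateSum P D w q.2.1 q.2.2.1 + P.S • (q.1 • direction P x w (q.2.1 j) +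
    P.σ • complementNoise (direction P x w (q.2.1 j)) q.2.2.2)

theorem measurable_simulate (P : Params N n m X Seed) (D : Federation N X) (x : X) (j : Fin N)
    (hsgd : ∀ x, Measurable fun p : Vec n × Seed => P.sgd x p.1 p.2) :
    Measurable fun p : Vec n × ℝ × (Fin N → Seed) × (Fin N → Bool) × Vec m =>
      simulate P D x j p.1 p.2 := by
  have h1 : Measurable fun p : Vec n × ℝ × (Fin N → Seed) × (Fin N → Bool) × Vec m =>
      updateSum P D p.1 p.2.2.1 p.2.2.2.1 :=
    (measurable_updateSum P D hsgd).comp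
      (f := fun p : Vec n × ℝ × (Fin N → Seed) × (Fin N → Bool) × Vec m =>
        (p.2.2.2.1, p.1, p.2.2.1)) (by fun_prop)
  have h2 : Measurable fun p : Vec n × ℝ × (Fin N → Seed) × (Fin N → Bool) × Vec m =>
      direction P x p.1 (p.2.2.1 j) := by
    have h : Measurable fun p : Vec n × ℝ × (Fin N → Seed) × (Fin N → Bool) × Vec m =>
        clippedUpdate P x p.1 (p.2.2.1 j) :=
      (measurable_clippedUpdate P x (hsgd x)).comp
        (f := fun p : Vec n × ℝ × (Fin N → Seed) × (Fin N → Bool) × Vec m =>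
          (p.1, p.2.2.1 j)) (by fun_prop)
    unfold direction
    fun_prop
  have h3 : Measurable fun p : Vec n × ℝ × (Fin N → Seed) × (Fin N → Bool) × Vec m =>
      complementNoise (direction P x p.1 (p.2.2.1 j)) p.2.2.2.2 :=
    measurable_complementNoise.comp (h2.prodMk (by fun_prop))
  unfold simulate
  fun_prop

/-- Adding the one-dimensional noise in direction `v` completes the noise. -/
theorem map_shift_complementNoise {v : Vec m} (hv : ‖v‖ ≤ 1) (S σ a : ℝ) (u : Vec m) :
    ((noiseLaw σ).prod (stdGaussian (Vec m))).map
      (fun p => u + S • ((a + p.1) • v + σ • complementNoise v p.2)) =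
    (stdGaussian (Vec m)).map fun g => u + (a * S) • v + (S * σ) • g := by
  have hm : Measurable (complementNoise v) :=
    measurable_complementNoise.comp measurable_prodMk_left
  have h := congrArg (Measure.map fun y => u + S • (a • v + y)) (map_add_complementNoise hv σ)
  rw [Measure.map_map (by fun_prop) (by fun_prop), Measure.map_map (by fun_prop) (by fun_prop)] at h
  convert h using 2
  · ext1 p
    simp only [Function.comp_apply, add_smul, add_assoc]
  · ext1 g
    simp only [Function.comp_apply, smul_add, smul_smul, add_assoc, mul_comm a S]

/-- To identify the law of a simulated aggregate one may fix the seeds. -/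
theorem map_simulate_eq {P : Params N n m X Seed} {D' : Federation N X} {j : Fin N} {x : X}
    (hsgd : ∀ x, Measurable fun p : Vec n × Seed => P.sgd x p.1 p.2)
    (hC0 : 0 < P.C) (hC1 : P.C ≤ 1) (seedLaw : Measure Seed)
    [IsProbabilityMeasure seedLaw]
    (κ : Measure ℝ) [SFinite κ] (E : Federation N X) (w : Vec n)
    (h : ∀ s : Fin N → Seed,
      ((Measure.pi fun _ : Fin N => selectionLaw P.C).prod (κ.prod (stdGaussian (Vec m)))).map
        (fun p => simulate P D' x j w (p.2.1, s, p.1, p.2.2)) =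
      ((Measure.pi fun _ : Fin N => selectionLaw P.C).prod (stdGaussian (Vec m))).map
        fun p => updateSum P E w s p.1 + (P.S * P.σ) • p.2) :
    (κ.prod (sortedLaw N m P.C seedLaw)).map (simulate P D' x j w) =
      (roundLaw N m P.C seedLaw).map (aggregate P E w) := by
  have := isProbabilityMeasure_selectionLaw hC0.le hC1
  have hF : Measurable (simulate P D' x j w) :=
    (measurable_simulate P D' x j hsgd).comp (f := fun q => (w, q)) (by fun_prop)
  have h2 : Measurable fun p : (Fin N → Seed) × (Fin N → Bool) × Vec m =>
      updateSum P E w p.1 p.2.1 + (P.S * P.σ) • p.2.2 :=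
    measurable_updateSum_add_noise P E hsgd w
  rw [map_aggregate P E hsgd hC0.le hC1, sortedLaw, map_prod_left_comm _ _ _ hF]
  refine map_prod_congr _ _ _
    (f := fun s (q : ℝ × (Fin N → Bool) × Vec m) => simulate P D' x j w (q.1, s, q.2))
    (g := fun s (q : (Fin N → Bool) × Vec m) => updateSum P E w s q.1 + (P.S * P.σ) • q.2)
    (hF.comp (f := fun p : (Fin N → Seed) × ℝ × (Fin N → Bool) × Vec m => (p.2.1, p.1, p.2.2))
      (by fun_prop)) h2 fun s => ?_
  have h3 : Measurable fun q : ℝ × (Fin N → Bool) × Vec m =>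
    simulate P D' x j w (q.1, s, q.2) :=
      hF.comp (f := fun q : ℝ × (Fin N → Bool) × Vec m => (q.1, s, q.2)) (by fun_prop)
  rw [map_prod_left_comm _ _ _ h3, ← h s]

theorem map_simulate_noiseLaw {P : Params N n m X Seed} {D' : Federation N X} {j : Fin N} {x : X}
    (hsgd : ∀ x, Measurable fun p : Vec n × Seed => P.sgd x p.1 p.2)
    (hC0 : 0 < P.C) (hC1 : P.C ≤ 1) (hS : 0 < P.S) (seedLaw : Measure Seed)
    [IsProbabilityMeasure seedLaw]
    (w : Vec n) :
    ((noiseLaw P.σ).prod (sortedLaw N m P.C seedLaw)).map (simulate P D' x j w) =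
      (roundLaw N m P.C seedLaw).map (aggregate P D' w) := by
  refine map_simulate_eq hsgd hC0 hC1 seedLaw _ _ w fun s => ?_
  have hF : Measurable (simulate P D' x j w) :=
    (measurable_simulate P D' x j hsgd).comp (f := fun q => (w, q)) (by fun_prop)
  have h2 : Measurable fun p : (Fin N → Bool) × Vec m =>
      updateSum P D' w s p.1 + (P.S * P.σ) • p.2 :=
    (measurable_updateSum_add_noise P D' hsgd w).comp (f := fun q => (s, q)) (by fun_prop)
  refine map_prod_congr _ _ _
    (f := fun b (q : ℝ × Vec m) => simulate P D' x j w (q.1, s, b, q.2))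
    (g := fun b (g : Vec m) => updateSum P D' w s b + (P.S * P.σ) • g)
    (hF.comp (f := fun p : (Fin N → Bool) × ℝ × Vec m => (p.2.1, s, p.1, p.2.2)) (by fun_prop)) h2 fun b => ?_
  -- Shift `0`: the real sample and the complement merely restore the full noise.
  simpa [simulate] using map_shift_complementNoise (norm_direction_le hS x w (s j)) P.S P.σ 0
    (updateSum P D' w s b)

theorem map_simulate_mixtureLaw {P : Params N n m X Seed} {D D' : Federation N X} {j : Fin N} {x : X}
    (hsgd : ∀ x, Measurable fun p : Vec n × Seed => P.sgd x p.1 p.2)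
    (hC0 : 0 < P.C) (hC1 : P.C ≤ 1) (hS : 0 < P.S) (seedLaw : Measure Seed)
    [IsProbabilityMeasure seedLaw]
    (hσ : 0 < P.σ) (hj : D j = some x) (hj' : D' j = none)
    (hne : ∀ k, k ≠ j → D k = D' k) (w : Vec n) :
    ((mixtureLaw P.σ P.C).prod (sortedLaw N m P.C seedLaw)).map (simulate P D' x j w) =
      (roundLaw N m P.C seedLaw).map (aggregate P D w) := by
  have := isProbabilityMeasure_mixtureLaw hσ hC0 hC1
  have := isProbabilityMeasure_selectionLaw hC0.le hC1
  refine map_simulate_eq hsgd hC0 hC1 seedLaw _ _ w fun s => ?_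
  have hF : Measurable (simulate P D' x j w) :=
    (measurable_simulate P D' x j hsgd).comp (f := fun q => (w, q)) (by fun_prop)
  have hG : Measurable fun p : (Fin N → Bool) × Vec m =>
      updateSum P D w s p.1 + (P.S * P.σ) • p.2 :=
    (measurable_updateSum_add_noise P D hsgd w).comp (f := fun q => (s, q)) (by fun_prop)
  have hup : Measurable fun p : (Fin N → Bool) × Bool => Function.update p.1 j p.2 :=
    measurable_update'
  have hadd : Measurable fun p : Bool × ℝ => (if p.1 = true then (1 : ℝ) else 0) + p.2 :=
    measurable_from_prod_countable_right fun b => by cases b <;> simp <;> fun_prop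
  -- The bit of client `j` is resampled independently, to be matched with the Bernoulli shift inside
  -- the mixture.
  rw [← map_update_pi_prod (selectionLaw P.C) j, map_map_prod_prod _ _ _ hup hG,
    map_update_pi_prod]
  refine map_prod_congr _ _ _
    (f := fun b (q : ℝ × Vec m) => simulate P D' x j w (q.1, s, b, q.2))
    (g := fun b (q : Bool × Vec m) =>
      updateSum P D w s (Function.update b j q.1) + (P.S * P.σ) • q.2)
    (hF.comp (f := fun p : (Fin N → Bool) × ℝ × Vec m => (p.2.1, s, p.1, p.2.2)) (by fun_prop))
    (hG.comp (f := fun p : (Fin N → Bool) × Bool × Vec m =>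
      (Function.update p.1 j p.2.1, p.2.2))
      ((hup.comp (by fun_prop : Measurable fun p : (Fin N → Bool) × Bool × Vec m =>
        (p.1, p.2.1))).prodMk (by fun_prop))) fun b => ?_
  have hFb : Measurable fun q : ℝ × Vec m => simulate P D' x j w (q.1, s, b, q.2) :=
    hF.comp (f := fun q : ℝ × Vec m => (q.1, s, b, q.2)) (by fun_prop)
  rw [mixtureLaw_eq_map hσ hC0 hC1, map_map_prod_prod _ _ _ hadd hFb]
  refine map_prod_congr _ _ _
    (f := fun β (q : ℝ × Vec m) =>
      simulate P D' x j w ((if β = true then 1 else 0) + q.1, s, b, q.2))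
    (g := fun β (g : Vec m) =>
      updateSum P D w s (Function.update b j β) + (P.S * P.σ) • g)
    (hFb.comp (f := fun p : Bool × ℝ × Vec m => ((if p.1 = true then 1 else 0) + p.2.1, p.2.2))
      ((hadd.comp (by fun_prop : Measurable fun p : Bool × ℝ × Vec m => (p.1, p.2.1))).prodMk
        (by fun_prop)))
    (measurable_from_prod_countable_right fun β => by fun_prop) fun β => ?_
  -- A shift of the real sample by `1` moves the aggregate by `S v`, which is the clipped update of
  -- client `j`.
  have h := map_shift_complementNoise (norm_direction_le hS x w (s j)) P.S P.σ
    (if β = true then 1 else 0) (updateSum P D' w s b)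
  simp only [simulate]
  rw [h]
  congr 1
  ext1 g
  rw [updateSum_update hj hj' hne]
  congr 2
  cases β
  · simp
  · simp [direction, smul_smul, hS.ne']

/-- The privacy loss between runs on federations that differ in one client, in both directions, for
any measurable function of the run. -/
theorem measure_lt_privacyLoss_run_le {P : Params N n m X Seed}
    (seedLaw : Measure Seed) [IsProbabilityMeasure seedLaw]
    (hsgd : ∀ x, Measurable fun p : Vec n × Seed => P.sgd x p.1 p.2)
    (hdec : Measurable P.decompress) (hC0 : 0 < P.C) (hC1 : P.C ≤ 1) (hS : 0 < P.S)
    (hσ : 0 < P.σ) (T : ℕ) {O : Type*} [MeasurableSpace O]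
    {Ψ : ServerState n m × Transcript T n m → O} (hΨ : Measurable Ψ) {D D' : Federation N X}
    {j : Fin N} {x : X} (hj : D j = some x) (hj' : D' j = none)
    (hne : ∀ k, k ≠ j → D k = D' k) {l : ℝ} (hl : 0 < l) (ε : ℝ) {μ ν : Measure O}
    (hμ : μ = (runLaw N m P.C seedLaw T).map fun r => Ψ (run P D T r))
    (hν : ν = (runLaw N m P.C seedLaw T).map fun r => Ψ (run P D' T r)) :
    μ {o | (ε : EReal) < privacyLoss μ ν o} ≤
        ENNReal.ofReal (Real.exp (T * alpha l P.σ P.C - l * ε)) ∧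
      ν {o | (ε : EReal) < privacyLoss ν μ o} ≤
        ENNReal.ofReal (Real.exp (T * alpha l P.σ P.C - l * ε)) := by
  have h1 := isProbabilityMeasure_selectionLaw hC0.le hC1
  have h2 := isProbabilityMeasure_mixtureLaw hσ hC0 hC1
  have h3 : IsProbabilityMeasure (sortedLaw N m P.C seedLaw) := by
    unfold sortedLaw; infer_instance
  have h4 : IsProbabilityMeasure (roundLaw N m P.C seedLaw) := by
    have : IsProbabilityMeasure (clientLaw m P.C seedLaw) := by
      change IsProbabilityMeasure
        ((selectionLaw P.C).prod (seedLaw.prod (stdGaussian (Vec m))))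
      infer_instance
    unfold roundLaw; infer_instance
  have hsim := measurable_simulate P D' x j hsgd
  -- For either federation the run has the law of one and the same map, with only the law `κ` of the
  -- real samples changing.
  have key : ∀ (κ : Measure ℝ) (E : Federation N X), IsProbabilityMeasure κ →
      (∀ w, (κ.prod (sortedLaw N m P.C seedLaw)).map (simulate P D' x j w) =
        (roundLaw N m P.C seedLaw).map (aggregate P E w)) →
      (runLaw N m P.C seedLaw T).map (fun r => Ψ (run P E T r)) =
        (Measure.pi fun _ : Fin T => κ.prod (sortedLaw N m P.C seedLaw)).map
          fun r => Ψ (runWith P (simulate P D' x j) T r) := by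
    intro κ E hκ hE
    have hagg := measurable_aggregate P E hsgd
    have h := congrArg (Measure.map Ψ) (map_runWith_congr P hdec _ _ hsim hagg hE T)
    rw [Measure.map_map hΨ (measurable_runWith P hdec hsim T),
      Measure.map_map hΨ (measurable_runWith P hdec hagg T), ← run_eq_runWith] at h
    exact h.symm
  exact measure_lt_privacyLoss_pi_le (sortedLaw N m P.C seedLaw) hσ hC0 hC1 T
    (hΨ.comp (measurable_runWith P hdec hsim T)) hl ε
    (hμ.trans (key _ D h2 fun w => map_simulate_mixtureLaw hsgd hC0 hC1 hS seedLaw hσ hj hj' hne w))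
    (hν.trans (key _ D' inferInstance fun w => map_simulate_noiseLaw hsgd hC0 hC1 hS seedLaw w))

/-- The loss event `B` satisfies `exp ε * μ B ≤ μ B < ⊤` with `exp ε > 1`, so it is null. -/
theorem measure_lt_privacyLoss_self {O : Type*} [MeasurableSpace O] (μ : Measure O)
    [IsFiniteMeasure μ] {ε : ℝ} (hε : 0 < ε) : μ {o | (ε : EReal) < privacyLoss μ μ o} = 0 := by
  have h := exp_mul_measure_lt_privacyLoss_le μ μ ε
  by_contra h0
  have h1 : 1 < ENNReal.ofReal (Real.exp ε) := by
    rw [← ENNReal.ofReal_one]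
    exact (ENNReal.ofReal_lt_ofReal_iff (Real.exp_pos _)).2 (Real.one_lt_exp_iff.2 hε)
  exact absurd h (not_le.2 (by
    simpa using ENNReal.mul_lt_mul_left h0 (measure_ne_top _ _) h1))

/-- Differential privacy of every measurable function of a run. -/
theorem isDP_map_run (P : Params N n m X Seed)
    (seedLaw : Measure Seed) [IsProbabilityMeasure seedLaw]
    (hsgd : ∀ x, Measurable fun p : Vec n × Seed => P.sgd x p.1 p.2)
    (hdec : Measurable P.decompress) (hC0 : 0 < P.C) (hC1 : P.C ≤ 1) (hS : 0 < P.S)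
    (hσ : 0 < P.σ) (T : ℕ) {O : Type*} [MeasurableSpace O]
    {Ψ : ServerState n m × Transcript T n m → O} (hΨ : Measurable Ψ) {l ε δ : ℝ} (hl : 0 < l)
    (hε : 0 < ε) (hδ : Real.exp (T * alpha l P.σ P.C - l * ε) ≤ δ) :
    IsDP Adjacent (fun D : Federation N X =>
      (runLaw N m P.C seedLaw T).map fun r => Ψ (run P D T r)) ε δ := by
  have hself : ∀ D : Federation N X, (runLaw N m P.C seedLaw T).map (fun r => Ψ (run P D T r))
      {o | (ε : EReal) < privacyLoss ((runLaw N m P.C seedLaw T).map fun r => Ψ (run P D T r))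
        ((runLaw N m P.C seedLaw T).map fun r => Ψ (run P D T r)) o} ≤ ENNReal.ofReal δ := by
    intro D
    have := isProbabilityMeasure_runLaw (N := N) (m := m) hC0.le hC1 seedLaw T
    rw [measure_lt_privacyLoss_self _ hε]
    exact zero_le
  rintro D D' (rfl | ⟨j, h0, hne⟩)
  · exact hself D
  -- Removal and addition of client `j` use the two halves of the two-sided bound; if `j` is absent
  -- on both sides the federations coincide, and presence on both sides is excluded by `h0`.
  · rcases hD : D j with _ | x <;> rcases hD' : D' j with _ | x'
    · have : D = D' := by
        ext1 k
        by_cases hk : k = j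
        · rw [hk, hD, hD']
        · exact hne k hk
      subst this
      exact hself D
    · exact (measure_lt_privacyLoss_run_le seedLaw hsgd hdec hC0 hC1 hS hσ T hΨ hD' hD
        (fun k hk => (hne k hk).symm) hl ε rfl rfl).2.trans (ENNReal.ofReal_le_ofReal hδ)
    · exact (measure_lt_privacyLoss_run_le seedLaw hsgd hdec hC0 hC1 hS hσ T hΨ hD hD'
        hne hl ε rfl rfl).1.trans (ENNReal.ofReal_le_ofReal hδ)
    · simp [hD, hD'] at h0

end Aggregate

end FLCSDP

end

theorem mainTheorem1 {N n m : ℕ} (hmn : m ≤ n) {X Seed : Type*} [MeasurableSpace Seed]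
    (seedLaw : MeasureTheory.Measure Seed) [MeasureTheory.IsProbabilityMeasure seedLaw]
    (P : FLCSDP.Params N n m X Seed)
    (hsgd : ∀ x, Measurable fun p : FLCSDP.Vec n × Seed => P.sgd x p.1 p.2)
    (hdec : Measurable P.decompress)
    (hC0 : 0 < P.C) (hC1 : P.C ≤ 1) (hS : 0 < P.S) (hσ : 0 < P.σ)
    (T : ℕ) (hT : 0 < T) (δ : ℝ) (hδ0 : 0 < δ) (hδ1 : δ < 1) :
    ∃ ε : ℝ,
      IsLeast ((fun l : ℝ => (T * FLCSDP.alpha l P.σ P.C - Real.log δ) / l) '' Set.Ioi 0) ε ∧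
      FLCSDP.IsDP FLCSDP.Adjacent (FLCSDP.transcriptLaw P seedLaw T) ε δ ∧
      FLCSDP.IsDP FLCSDP.Adjacent (FLCSDP.outputLaw P seedLaw T) ε δ := by
  obtain ⟨l, hl, hmin⟩ := FLCSDP.exists_isMin_bound hσ hC0 hC1 hT hδ0 hδ1
  set ε := (T * FLCSDP.alpha l P.σ P.C - Real.log δ) / l with hεdef
  -- Strict positivity handles the case of equal federations.
  have hε : 0 < ε := by
    have h1 := mul_nonneg (Nat.cast_nonneg (α := ℝ) T) (FLCSDP.alpha_nonneg hσ hC0 hC1 hl)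
    have h2 := Real.log_neg hδ0 hδ1
    exact div_pos (by linarith) hl
  -- By the choice of `ε`, the exponent `T α - l ε` equals `log δ`.
  have hδ : Real.exp (T * FLCSDP.alpha l P.σ P.C - l * ε) ≤ δ := by
    rw [hεdef, mul_div_cancel₀ _ hl.ne', sub_sub_cancel, Real.exp_log hδ0]
  refine ⟨ε, ⟨⟨l, hl, rfl⟩, ?_⟩, ?_, ?_⟩
  · rintro _ ⟨l', hl', rfl⟩
    exact hmin l' hl'
  · exact FLCSDP.isDP_map_run P seedLaw hsgd hdec hC0 hC1 hS hσ T measurable_snd hl hε hδ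
  · exact FLCSDP.isDP_map_run P seedLaw hsgd hdec hC0 hC1 hS hσ T measurable_fst.fst hl hε hδ
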